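/- Let $(M,g)$ be a connected, geodesically complete smooth Riemannian manifold (finite-dimensional, Hausdorff, without boundary) with Riemannian distance $d$ and Levi-Civita connection $\nabla$. Let $X$ be a smooth vector field on $M$ with (maximal, local) flow $\mathrm{Fl}^X$. For $p\in M$ let $\|\nabla X(p)\|_g$ denote the operator norm of the linear map $T_pM\to T_pM$, $Y\mapsto\nabla_Y X$, with respect to the norm induced by $g$. Let $p_0,q_0\in M$ and let $S\subseteq M$ be a minimizing geodesic segment connecting $p_0$ and $q_0$, i.e. the image of a geodesic $\gamma:[0,1]\to M$ with $\gamma(0)=p_0$, $\gamma(1)=q_0$ whose length equals $d(p_0,q_0)$. Put $p(t)=\mathrm{Fl}^X_t(p_0)$ and $q(t)=\mathrm{Fl}^X_t(q_0)$. If $T>0$ is such that $\mathrm{Fl}^X$ is defined on $[0,T]\times S$, then $$C_T:=\sup\{\|\nabla X(p)\|_g : p\in \mathrm{Fl}^X([0,T]\times S)\}$$ is finite, and $$d(p(t),q(t))\le d(p_0,q_0)\,e^{C_T t}\qquad (t\in[0,T]).$$ In particular, if $X$ is complete, then this holds for every $T>0$. -/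

import Mathlib

open Set Bundle FiberBundle Manifold
open scoped Manifold Bundle ContDiff Topology ENNReal

set_option linter.unusedSectionVars false

noncomputable section

namespace RiemannianGronwall

section LeviCivita

variable {E : Type*} [NormedAddCommGroup E] [NormedSpace ℝ E] [FiniteDimensional ℝ E]
  {H : Type*} [TopologicalSpace H] {I : ModelWithCorners ℝ E H}
  {M : Type*} [TopologicalSpace M] [ChartedSpace H M] [IsManifold I ∞ M]
  [RiemannianBundle (fun x : M ↦ TangentSpace I x)]
  [IsContMDiffRiemannianBundle I ∞ E (fun x : M ↦ TangentSpace I x)]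

/-- The Koszul expression: for the Levi-Civita connection `∇`, it is the value at `x` of
`g(∇_Y X, Z)`. -/
def koszul (X Y Z : Π x : M, TangentSpace I x) (x : M) : ℝ :=
  (1 / 2 : ℝ) *
    (mvfderiv I (fun y : M ↦ inner ℝ (X y) (Z y)) x (Y x)
      + mvfderiv I (fun y : M ↦ inner ℝ (Z y) (Y y)) x (X x)
      - mvfderiv I (fun y : M ↦ inner ℝ (Y y) (X y)) x (Z x)
      + inner ℝ (VectorField.mlieBracket I Y X x) (Z x)
      - inner ℝ (VectorField.mlieBracket I X Z x) (Y x)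
      + inner ℝ (VectorField.mlieBracket I Z Y x) (X x))

variable {X X' Y Z : Π x : M, TangentSpace I x} {x : M}

theorem mdiffAt_inner (hX : MDiffAt (T% X) x) (hY : MDiffAt (T% Y) x) :
    MDiffAt (fun y ↦ inner ℝ (X y) (Y y)) x :=
  MDifferentiableAt.inner_bundle (IB := I) (F := E) (E := fun x : M ↦ TangentSpace I x)
    (b := fun y ↦ y) hX hY

theorem mvfderiv_inner_smul_left {f : M → ℝ} (hf : MDiffAt f x) (hX : MDiffAt (T% X) x)
    (hY : MDiffAt (T% Y) x) :
    mvfderiv I (fun y ↦ inner ℝ ((f • X) y) (Y y)) x =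
      f x • mvfderiv I (fun y ↦ inner ℝ (X y) (Y y)) x + inner ℝ (X x) (Y x) • mvfderiv I f x := by
  rw [← mvfderiv_fun_mul hf (mdiffAt_inner hX hY)]
  simp [inner_smul_left]

theorem mvfderiv_inner_smul_right {f : M → ℝ} (hf : MDiffAt f x) (hX : MDiffAt (T% X) x)
    (hY : MDiffAt (T% Y) x) :
    mvfderiv I (fun y ↦ inner ℝ (X y) ((f • Y) y)) x =
      f x • mvfderiv I (fun y ↦ inner ℝ (X y) (Y y)) x + inner ℝ (X x) (Y x) • mvfderiv I f x := by
  rw [← mvfderiv_fun_mul hf (mdiffAt_inner hX hY)]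
  simp [inner_smul_right]

theorem mvfderiv_inner_add_left (hX : MDiffAt (T% X) x) (hX' : MDiffAt (T% X') x)
    (hY : MDiffAt (T% Y) x) :
    mvfderiv I (fun y ↦ inner ℝ ((X + X') y) (Y y)) x =
      mvfderiv I (fun y ↦ inner ℝ (X y) (Y y)) x
        + mvfderiv I (fun y ↦ inner ℝ (X' y) (Y y)) x := by
  rw [← mvfderiv_fun_add (mdiffAt_inner hX hY) (mdiffAt_inner hX' hY)]
  simp [inner_add_left]

theorem mvfderiv_inner_add_right (hX : MDiffAt (T% X) x) (hX' : MDiffAt (T% X') x)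
    (hY : MDiffAt (T% Y) x) :
    mvfderiv I (fun y ↦ inner ℝ (Y y) ((X + X') y)) x =
      mvfderiv I (fun y ↦ inner ℝ (Y y) (X y)) x
        + mvfderiv I (fun y ↦ inner ℝ (Y y) (X' y)) x := by
  rw [← mvfderiv_fun_add (mdiffAt_inner hY hX) (mdiffAt_inner hY hX')]
  simp [inner_add_right]

theorem koszul_tensorial_right (hX : MDiffAt (T% X) x) (hY : MDiffAt (T% Y) x) :
    TensorialAt I E (koszul X Y · x) x where
  smul {f Z} hf hZ := by
    have : CompleteSpace E := FiniteDimensional.complete ℝ E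
    simp only [koszul, mvfderiv_inner_smul_left hf hZ hY, mvfderiv_inner_smul_right hf hX hZ,
      VectorField.mlieBracket_smul_left hf hZ, VectorField.mlieBracket_smul_right hf hZ]
    simp [inner_add_left, inner_smul_left, inner_smul_right]
    rw [real_inner_comm (Y x) (Z x), real_inner_comm (X x) (Z x)]
    ring
  add {Z Z'} hZ hZ' := by
    have : CompleteSpace E := FiniteDimensional.complete ℝ E
    simp only [koszul, mvfderiv_inner_add_left hZ hZ' hY, mvfderiv_inner_add_right hZ hZ' hX,
      VectorField.mlieBracket_add_left hZ hZ', VectorField.mlieBracket_add_right hZ hZ']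
    simp [inner_add_left, inner_add_right]
    ring

theorem koszul_tensorial_left (hX : MDiffAt (T% X) x) (hZ : MDiffAt (T% Z) x) :
    TensorialAt I E (koszul X · Z x) x where
  smul {f Y} hf hY := by
    have : CompleteSpace E := FiniteDimensional.complete ℝ E
    simp only [koszul, mvfderiv_inner_smul_left hf hY hX, mvfderiv_inner_smul_right hf hZ hY,
      VectorField.mlieBracket_smul_left hf hY, VectorField.mlieBracket_smul_right hf hY]
    simp [inner_add_left, inner_smul_left, inner_smul_right]
    rw [real_inner_comm (Y x) (Z x), real_inner_comm (X x) (Y x)]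
    ring
  add {Y Y'} hY hY' := by
    have : CompleteSpace E := FiniteDimensional.complete ℝ E
    simp only [koszul, mvfderiv_inner_add_left hY hY' hX, mvfderiv_inner_add_right hY hY' hZ,
      VectorField.mlieBracket_add_left hY hY', VectorField.mlieBracket_add_right hY hY']
    simp [inner_add_left, inner_add_right]
    ring

instance instFiniteDimensionalTangentSpace (x : M) : FiniteDimensional ℝ (TangentSpace I x) :=
  inferInstanceAs (FiniteDimensional ℝ E)

open scoped Classical in
/-- The covariant differential `∇X (x) : T_xM → T_xM`, `Y ↦ ∇_Y X`, of the Levi-Civita connection: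
`∇_Y X` is the vector whose inner product with each `Z` is given by the Koszul formula.
(Value `0` at points where `X` is not differentiable.) -/
def leviCivitaFun (X : Π x : M, TangentSpace I x) (x : M) :
    TangentSpace I x →L[ℝ] TangentSpace I x :=
  if hX : MDiffAt (T% X) x then
    haveI : CompleteSpace (TangentSpace I x) := FiniteDimensional.complete ℝ _
    LinearMap.toContinuousLinearMap
      { toFun := fun v ↦ (InnerProductSpace.toDual ℝ (TangentSpace I x)).symm
          (TensorialAt.mkHom₂ (I := I) (F := E) (F' := E) (V := fun x : M ↦ TangentSpace I x)
            (V' := fun x : M ↦ TangentSpace I x) (fun Y Z ↦ koszul X Y Z x) x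
            (fun _ hZ ↦ koszul_tensorial_left hX hZ)
            (fun _ hY ↦ koszul_tensorial_right hX hY) v)
        map_add' := fun v w ↦ by simp
        map_smul' := fun c v ↦ by simp }
  else 0

theorem inner_leviCivitaFun (hX : MDiffAt (T% X) x) (hY : MDiffAt (T% Y) x)
    (hZ : MDiffAt (T% Z) x) :
    inner ℝ (leviCivitaFun X x (Y x)) (Z x) = koszul X Y Z x := by
  have : CompleteSpace (TangentSpace I x) := FiniteDimensional.complete ℝ _
  rw [leviCivitaFun, dif_pos hX]
  simp only [LinearMap.coe_toContinuousLinearMap', LinearMap.coe_mk, AddHom.coe_mk,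
    InnerProductSpace.toDual_symm_apply]
  exact TensorialAt.mkHom₂_apply (I := I) (F := E) (F' := E) (V := fun x : M ↦ TangentSpace I x)
    (V' := fun x : M ↦ TangentSpace I x) (Φ := fun Y Z ↦ koszul X Y Z x)
    (fun _ hZ ↦ koszul_tensorial_left hX hZ) (fun _ hY ↦ koszul_tensorial_right hX hY) hY hZ

theorem ext_inner_extend {v w : TangentSpace I x}
    (h : ∀ Z : Π y : M, TangentSpace I y, MDiffAt (T% Z) x →
      inner ℝ v (Z x) = inner ℝ w (Z x)) : v = w := by
  refine ext_inner_right ℝ fun z ↦ ?_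
  simpa using h (extend E z) (mdifferentiableAt_extend ..)

theorem ext_clm_extend {A B : TangentSpace I x →L[ℝ] TangentSpace I x}
    (h : ∀ Y Z : Π y : M, TangentSpace I y, MDiffAt (T% Y) x → MDiffAt (T% Z) x →
      inner ℝ (A (Y x)) (Z x) = inner ℝ (B (Y x)) (Z x)) : A = B := by
  ext1 y
  refine ext_inner_extend fun Z hZ ↦ ?_
  simpa using h (extend E y) Z (mdifferentiableAt_extend ..) hZ

variable (I M) in
/-- The Levi-Civita connection of a Riemannian manifold. -/
def leviCivita : CovariantDerivative I E (fun x : M ↦ TangentSpace I x) where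
  toFun := leviCivitaFun
  isCovariantDerivativeOnUniv :=
    { add := by
        intro X X' x hX hX' _
        have : CompleteSpace E := FiniteDimensional.complete ℝ E
        refine ext_clm_extend fun Y Z hY hZ ↦ ?_
        rw [inner_leviCivitaFun (mdifferentiableAt_add_section hX hX') hY hZ]
        simp only [add_apply, inner_add_left, inner_leviCivitaFun hX hY hZ,
          inner_leviCivitaFun hX' hY hZ]
        simp only [koszul, mvfderiv_inner_add_left hX hX' hZ, mvfderiv_inner_add_right hX hX' hY,
          VectorField.mlieBracket_add_left hX hX', VectorField.mlieBracket_add_right hX hX']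
        simp [inner_add_left, inner_add_right]
        ring
      leibniz := by
        intro X f x hX hf _
        have : CompleteSpace E := FiniteDimensional.complete ℝ E
        refine ext_clm_extend fun Y Z hY hZ ↦ ?_
        rw [inner_leviCivitaFun (hf.smul_section hX) hY hZ]
        simp only [add_apply, smul_apply, inner_add_left,
          inner_smul_left, inner_leviCivitaFun hX hY hZ]
        simp only [koszul, mvfderiv_inner_smul_left hf hX hZ, mvfderiv_inner_smul_right hf hY hX,
          VectorField.mlieBracket_smul_left hf hX, VectorField.mlieBracket_smul_right hf hX]
        simp [inner_add_left, inner_smul_left, inner_smul_right]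
        rw [real_inner_comm (X x) (Y x)]
        ring }

theorem inner_leviCivita (hX : MDiffAt (T% X) x) (hY : MDiffAt (T% Y) x)
    (hZ : MDiffAt (T% Z) x) :
    inner ℝ (leviCivita I M X x (Y x)) (Z x) = koszul X Y Z x :=
  inner_leviCivitaFun hX hY hZ

/-- The Levi-Civita connection is compatible with the metric. -/
theorem leviCivita_metric (hX : MDiffAt (T% X) x) (hY : MDiffAt (T% Y) x)
    (hZ : MDiffAt (T% Z) x) :
    mvfderiv I (fun y : M ↦ inner ℝ (X y) (Y y)) x (Z x) =
      inner ℝ (leviCivita I M X x (Z x)) (Y x) + inner ℝ (X x) (leviCivita I M Y x (Z x)) := by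
  rw [inner_leviCivita hX hZ hY, real_inner_comm, inner_leviCivita hY hZ hX]
  simp only [koszul, VectorField.mlieBracket_swap_apply (V := Y) (W := X),
    VectorField.mlieBracket_swap_apply (V := Z) (W := X),
    VectorField.mlieBracket_swap_apply (V := Z) (W := Y), inner_neg_left]
  have e (A B : Π x : M, TangentSpace I x) : (fun y : M ↦ inner ℝ (A y) (B y)) =
    fun y ↦ inner ℝ (B y) (A y) := by ext y; exact real_inner_comm _ _
  rw [e Y X, e Z X, e Y Z]
  ring

variable (I M) in
/-- The Levi-Civita connection is torsion-free. -/
theorem torsion_leviCivita [CompleteSpace E] : (leviCivita I M).torsion = 0 := by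
  rw [CovariantDerivative.torsion_eq_zero_iff]
  intro X Y x hX hY
  refine ext_inner_extend fun Z hZ ↦ ?_
  rw [inner_sub_left, inner_leviCivita hY hX hZ, inner_leviCivita hX hY hZ]
  simp only [koszul, VectorField.mlieBracket_swap_apply (V := Y) (W := X),
    VectorField.mlieBracket_swap_apply (V := Z) (W := X),
    VectorField.mlieBracket_swap_apply (V := Z) (W := Y), inner_neg_left]
  have e (A B : Π x : M, TangentSpace I x) : (fun y : M ↦ inner ℝ (A y) (B y)) =
    fun y ↦ inner ℝ (B y) (A y) := by ext y; exact real_inner_comm _ _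
  rw [e Y X, e Z X, e Y Z]
  ring

end LeviCivita

section Geodesic

variable {E : Type*} [NormedAddCommGroup E] [NormedSpace ℝ E] [FiniteDimensional ℝ E]
  {H : Type*} [TopologicalSpace H] (I : ModelWithCorners ℝ E H)
  {M : Type*} [TopologicalSpace M] [ChartedSpace H M] [IsManifold I ∞ M]
  [RiemannianBundle (fun x : M ↦ TangentSpace I x)]
  [IsContMDiffRiemannianBundle I ∞ E (fun x : M ↦ TangentSpace I x)]

/-- The velocity `γ'(t)` of a curve. -/
def velocity {E : Type*} [NormedAddCommGroup E] [NormedSpace ℝ E]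
    {H : Type*} [TopologicalSpace H] (I : ModelWithCorners ℝ E H)
    {M : Type*} [TopologicalSpace M] [ChartedSpace H M] (γ : ℝ → M) (t : ℝ) :
    TangentSpace I (γ t) :=
  mfderiv 𝓘(ℝ, ℝ) I γ t (1 : ℝ)

/-- The covariant derivative `DV/dt` at `t` of a vector field `V` along a curve `γ`. In the local
frame `e_i` of the tangent bundle centered at `γ t`, with `V = ∑ V^i e_i`, it is
`∑ (V^i)'(t) e_i + ∑ V^i(t) ∇_{γ'(t)} e_i`. -/
def covDerivAlong (γ : ℝ → M) (V : Π s : ℝ, TangentSpace I (γ s)) (t : ℝ) :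
    TangentSpace I (γ t) :=
  (trivializationAt E (fun x : M ↦ TangentSpace I x) (γ t)).symm (γ t)
      (deriv (fun s ↦ (trivializationAt E (fun x : M ↦ TangentSpace I x) (γ t) ⟨γ s, V s⟩).2) t)
    + leviCivita I M (fun y : M ↦ (extend E (V t) y : TangentSpace I y)) (γ t) (velocity I γ t)

/-- `γ` is a geodesic on `s`: it is smooth and its covariant acceleration vanishes. -/
def IsGeodesicOn (γ : ℝ → M) (s : Set ℝ) : Prop :=
  ∀ t ∈ s, ContMDiffAt 𝓘(ℝ, ℝ) I ∞ γ t ∧ covDerivAlong I γ (velocity I γ) t = 0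

variable (M) in
/-- Geodesic completeness: every initial vector is the velocity at time `0` of a geodesic that is
defined on all of `ℝ`. -/
def GeodesicallyComplete : Prop :=
  ∀ v : TangentBundle I M, ∃ γ : ℝ → M, IsGeodesicOn I γ univ ∧
    (⟨γ 0, velocity I γ 0⟩ : TangentBundle I M) = v

/-- `S` is (the image of) a minimizing geodesic segment from `p₀` to `q₀`: a geodesic arc whose
length is the Riemannian distance of its endpoints. -/
def IsMinimizingGeodesicSegment (S : Set M) (p₀ q₀ : M) : Prop :=
  ∃ γ : ℝ → M, IsGeodesicOn I γ (Icc 0 1) ∧ γ 0 = p₀ ∧ γ 1 = q₀ ∧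
    pathELength I γ 0 1 = riemannianEDist I p₀ q₀ ∧ S = γ '' Icc 0 1

/-- The values of `‖∇X‖_g` (operator norm with respect to the Riemannian norm) on `A`. -/
def covDiffNorms (X : Π x : M, TangentSpace I x) (A : Set M) : Set ℝ :=
  (fun p ↦ ‖leviCivita I M X p‖) '' A

end Geodesic

section Flow

variable {E : Type*} [NormedAddCommGroup E] [NormedSpace ℝ E]
  {H : Type*} [TopologicalSpace H] {I : ModelWithCorners ℝ E H}
  {M : Type*} [TopologicalSpace M] [ChartedSpace H M]

/-- `γ` is an integral curve of `X` with `γ 0 = p`, on some open interval containing `0` and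
`t`. -/
def IsIntegralCurveThrough (X : Π x : M, TangentSpace I x) (p : M) (t : ℝ) (γ : ℝ → M) : Prop :=
  γ 0 = p ∧ ∃ a b : ℝ, 0 ∈ Ioo a b ∧ t ∈ Ioo a b ∧ IsMIntegralCurveOn γ X (Ioo a b)

/-- The domain of the (maximal) flow of `X`: the pairs `(t, p)` such that the integral curve of `X`
starting at `p` exists up to time `t`. -/
def flowDomain (X : Π x : M, TangentSpace I x) : Set (ℝ × M) :=
  {z | ∃ γ : ℝ → M, IsIntegralCurveThrough X z.2 z.1 γ}

open scoped Classical in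
/-- The flow `Fl^X_t(p)` of `X` (with the irrelevant value `p` outside of the flow domain). -/
def flow (X : Π x : M, TangentSpace I x) (t : ℝ) (p : M) : M :=
  if h : (t, p) ∈ flowDomain X then h.choose t else p

/-- `X` is complete: its flow is defined on `ℝ × M`. -/
def IsCompleteVectorField (X : Π x : M, TangentSpace I x) : Prop :=
  flowDomain X = univ

/-- The flow is given by any integral curve. -/
theorem flow_eq [BoundarylessManifold I M] [IsManifold I 1 M] [CompleteSpace E] [T2Space M]
    {X : Π x : M, TangentSpace I x}
    (hX : ContMDiff I I.tangent 1 (fun x : M ↦ (⟨x, X x⟩ : TangentBundle I M)))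
    {p : M} {t : ℝ} {γ : ℝ → M} (hγ : IsIntegralCurveThrough X p t γ) :
    flow X t p = γ t := by
  have h : (t, p) ∈ flowDomain X := ⟨γ, hγ⟩
  rw [flow, dif_pos h]
  obtain ⟨h0, a, b, ha, hb, hab⟩ := h.choose_spec
  obtain ⟨h0', a', b', ha', hb', hab'⟩ := hγ
  have key := isMIntegralCurveOn_Ioo_eqOn_of_contMDiff_boundaryless (t₀ := 0)
    (a := max a a') (b := min b b') (by simp_all)  hX
    (hab.mono (Ioo_subset_Ioo (le_max_left _ _) (min_le_left _ _)))
    (hab'.mono (Ioo_subset_Ioo (le_max_right _ _) (min_le_right _ _))) (h0.trans h0'.symm)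
  exact key (by simp_all)

end Flow

end RiemannianGronwall

end

noncomputable section

namespace RiemannianGronwall

section Analysis

/-- Forward induction along a compact interval: a property that holds at the left endpoint and
propagates forward near every point holds on the whole interval. -/
theorem Icc_forward_induction {T : ℝ} {P : ℝ → Prop} (h0 : P 0)
    (hstep : ∀ t₀ ∈ Icc 0 T, ∃ η > 0, ∀ t₁ ∈ Icc 0 T, ∀ t₂ ∈ Icc 0 T,
      |t₁ - t₀| < η → |t₂ - t₀| < η → t₁ ≤ t₂ → P t₁ → P t₂) :
    ∀ t ∈ Icc 0 T, P t := by
  intro t ht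
  choose! η hη hP using hstep
  obtain ⟨τ, hτ0, hτm, ⟨n, hn⟩, hτ⟩ := exists_monotone_Icc_subset_open_cover_Icc
    (c := fun s : Icc (0 : ℝ) T ↦ {t : Icc (0 : ℝ) T | |(t : ℝ) - s| < η s})
    (ht.1.trans ht.2) (fun s ↦ isOpen_lt (by fun_prop) continuous_const)
    (fun s _ ↦ mem_iUnion.2 ⟨s, by simpa using hη s s.2⟩)
  have key (k : ℕ) : ∀ s ∈ Icc 0 T, s ≤ τ k → P s := by
    induction k with
    | zero =>
      intro s hs hsk
      obtain rfl : s = 0 := le_antisymm (by simpa [hτ0] using hsk) hs.1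
      exact h0
    | succ k ih =>
      intro s hs hsk
      rcases le_total s (τ k) with h | h
      · exact ih s hs h
      obtain ⟨i, hi⟩ := hτ k
      have h1 : |(τ k : ℝ) - i| < η i := hi ⟨le_rfl, hτm (Nat.le_succ k)⟩
      have h2 : |s - i| < η i := hi (a := ⟨s, hs⟩) ⟨h, hsk⟩
      exact hP i i.2 (τ k) (τ k).2 s hs h1 h2 h (ih _ (τ k).2 le_rfl)
  exact key n t ht (by rw [hn n le_rfl]; exact ht.2)

variable {E : Type*} [NormedAddCommGroup E] [NormedSpace ℝ E]

instance bilinFormNormedAddCommGroup : NormedAddCommGroup (E →L[ℝ] E →L[ℝ] ℝ) :=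
  ContinuousLinearMap.toNormedAddCommGroup

instance bilinFormSeminormedAddCommGroup : SeminormedAddCommGroup (E →L[ℝ] E →L[ℝ] ℝ) :=
  bilinFormNormedAddCommGroup.toSeminormedAddCommGroup

instance bilinFormNormedSpace : NormedSpace ℝ (E →L[ℝ] E →L[ℝ] ℝ) :=
  ContinuousLinearMap.toNormedSpace

theorem exists_coercive_of_pos [FiniteDimensional ℝ E] {b : E →L[ℝ] E →L[ℝ] ℝ}
    (hb : ∀ v, v ≠ 0 → 0 < b v v) : ∃ m > 0, ∀ v, m * ‖v‖ ^ 2 ≤ b v v := by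
  have : ProperSpace E := FiniteDimensional.proper ℝ E
  rcases (Metric.sphere (0 : E) 1).eq_empty_or_nonempty with h | h
  · refine ⟨1, one_pos, fun v ↦ ?_⟩
    obtain rfl : v = 0 := by
      by_contra hv
      have : ‖v‖⁻¹ • v ∈ Metric.sphere (0 : E) 1 := by simp [norm_smul, hv]
      simp [h] at this
    simp
  · obtain ⟨v₀, hv₀, hmin⟩ := (isCompact_sphere (0 : E) 1).exists_isMinOn h
      (f := fun v ↦ b v v) (by fun_prop)
    have hv₀1 : ‖v₀‖ = 1 := by simpa using hv₀
    refine ⟨b v₀ v₀, hb _ (by rintro rfl; simp at hv₀1), fun v ↦ ?_⟩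
    rcases eq_or_ne v 0 with rfl | hv
    · simp
    have h1 : b v₀ v₀ ≤ b (‖v‖⁻¹ • v) (‖v‖⁻¹ • v) :=
      hmin (show ‖v‖⁻¹ • v ∈ Metric.sphere (0 : E) 1 by simp [norm_smul, hv])
    have hn : 0 < ‖v‖ := norm_pos_iff.2 hv
    simp only [map_smul, smul_apply, smul_eq_mul] at h1
    have : b v v = (‖v‖⁻¹ * (‖v‖⁻¹ * b v v)) * ‖v‖ ^ 2 := by field_simp
    rw [this]
    gcongr

theorem abs_bilin_sub_le (b c : E →L[ℝ] E →L[ℝ] ℝ) (v w : E) :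
    |b v w - c v w| ≤ ‖b - c‖ * ‖v‖ * ‖w‖ := by
  simpa using (b - c).le_opNorm₂ v w

theorem eventually_coercive [FiniteDimensional ℝ E] {X : Type*} [TopologicalSpace X]
    {G : X → E →L[ℝ] E →L[ℝ] ℝ} {x : X}
    (hG : ContinuousAt G x) (hpos : ∀ v, v ≠ 0 → 0 < G x v v) :
    ∃ m > 0, ∀ᶠ y in 𝓝 x, ∀ v, m * ‖v‖ ^ 2 ≤ G y v v := by
  obtain ⟨m, hm, h⟩ := exists_coercive_of_pos hpos
  refine ⟨m / 2, by positivity, ?_⟩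
  filter_upwards [Metric.continuousAt_iff'.1 hG (m / 2) (by positivity)] with y hy v
  rw [dist_eq_norm] at hy
  have h1 := abs_le.1 (abs_bilin_sub_le (G y) (G x) v v)
  nlinarith [h v, sq_nonneg ‖v‖]

/-- A continuous family of positive definite bilinear forms varies by small factors. -/
theorem eventually_quadratic_le [FiniteDimensional ℝ E] {X : Type*} [TopologicalSpace X]
    {G : X → E →L[ℝ] E →L[ℝ] ℝ} {x : X}
    (hG : ContinuousAt G x) (hpos : ∀ v, v ≠ 0 → 0 < G x v v) {ε : ℝ} (hε : 0 < ε) :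
    ∀ᶠ y in 𝓝 x, ∀ v, G y v v ≤ (1 + ε) * G x v v := by
  obtain ⟨m, hm, h⟩ := exists_coercive_of_pos hpos
  filter_upwards [Metric.continuousAt_iff'.1 hG (ε * m) (by positivity)] with y hy v
  rw [dist_eq_norm] at hy
  have h1 := abs_le.1 (abs_bilin_sub_le (G y) (G x) v v)
  nlinarith [h v, sq_nonneg ‖v‖]

theorem le_exp_mul_of_deriv_le {f f' : ℝ → ℝ} {a b K : ℝ} (hab : a ≤ b)
    (hf : ∀ t ∈ Icc a b, HasDerivAt f (f' t) t) (hle : ∀ t ∈ Icc a b, f' t ≤ K * f t) :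
    f b ≤ Real.exp (K * (b - a)) * f a := by
  have hd (t : ℝ) (ht : t ∈ Icc a b) : HasDerivAt (fun t ↦ Real.exp (-K * (t - a)) * f t)
      (Real.exp (-K * (t - a)) * (-K * 1) * f t + Real.exp (-K * (t - a)) * f' t) t :=
    ((((hasDerivAt_id t).sub_const a).const_mul (-K)).exp).mul (hf t ht)
  have hanti : AntitoneOn (fun t ↦ Real.exp (-K * (t - a)) * f t) (Icc a b) := by
    refine antitoneOn_of_deriv_nonpos (convex_Icc a b)
      (fun t ht ↦ (hd t ht).continuousAt.continuousWithinAt)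
      (fun t ht ↦ (hd t (interior_subset ht)).differentiableAt.differentiableWithinAt) ?_
    intro t ht
    rw [(hd t (interior_subset ht)).deriv]
    nlinarith [hle t (interior_subset ht), Real.exp_pos (-K * (t - a))]
  have h := hanti (left_mem_Icc.2 hab) (right_mem_Icc.2 hab) hab
  simp only [sub_self, mul_zero, Real.exp_zero, one_mul] at h
  calc f b = Real.exp (K * (b - a)) * (Real.exp (-K * (b - a)) * f b) := by
        rw [← mul_assoc, ← Real.exp_add]; simp
    _ ≤ _ := by gcongr

/-- Two nearby integral curves of a vector field `F` in a vector space endowed with a metric `G`: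
if half the Lie derivative of `G` along `F` is bounded by `C G` along the first curve, then the
`G`-length of their difference grows at most at the exponential rate `C + ε`. -/
theorem exists_ball_metric_gronwall [FiniteDimensional ℝ E] {G : E → E →L[ℝ] E →L[ℝ] ℝ}
    {F : E → E} {u₀ : E} (hG : ContDiffAt ℝ 1 G u₀) (hF : ContDiffAt ℝ 1 F u₀)
    (hsymm : ∀ᶠ u in 𝓝 u₀, ∀ v w, G u v w = G u w v) (hpos : ∀ v, v ≠ 0 → 0 < G u₀ v v)
    (C : ℝ) {ε : ℝ} (hε : 0 < ε) :
    ∃ δ > 0, ∀ (a b : ℝ) (u v : ℝ → E), a ≤ b →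
      (∀ t ∈ Icc a b, u t ∈ Metric.ball u₀ δ ∧ v t ∈ Metric.ball u₀ δ ∧
        HasDerivAt u (F (u t)) t ∧ HasDerivAt v (F (v t)) t ∧
        ∀ w, fderiv ℝ G (u t) (F (u t)) w w + 2 * G (u t) (fderiv ℝ F (u t) w) w
          ≤ 2 * C * G (u t) w w) →
      G (u b) (v b - u b) (v b - u b)
        ≤ Real.exp (2 * (C + ε) * (b - a)) * G (u a) (v a - u a) (v a - u a) := by
  obtain ⟨m, hm, hcoer⟩ := eventually_coercive hG.continuousAt hpos
  set B : ℝ := ‖G u₀‖ + 1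
  have hB : 0 < B := by positivity
  have hGB : ∀ᶠ u in 𝓝 u₀, ‖G u‖ < B :=
    (continuous_norm.continuousAt.comp hG.continuousAt).eventually_lt_const (lt_add_one _)
  set η : ℝ := ε * m / (2 * B)
  have hη : 0 < η := by positivity
  have hGd : ∀ᶠ u in 𝓝 u₀, DifferentiableAt ℝ G u := by
    filter_upwards [hG.eventually (by simp)] with u hu using hu.differentiableAt one_ne_zero
  have hFd : ∀ᶠ u in 𝓝 u₀, ‖fderiv ℝ F u - fderiv ℝ F u₀‖ < η := by
    have := (hF.fderiv_right (m := 0) (by simp)).continuousAt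
    filter_upwards [Metric.continuousAt_iff'.1 this η hη] with u hu
    rwa [← dist_eq_norm]
  have hFs : ∀ᶠ p : E × E in 𝓝 (u₀, u₀),
      ‖F p.1 - F p.2 - fderiv ℝ F u₀ (p.1 - p.2)‖ ≤ η * ‖p.1 - p.2‖ :=
    (hF.hasStrictFDerivAt one_ne_zero).isLittleO.def hη
  rw [nhds_prod_eq] at hFs
  obtain ⟨V, hV, hFV⟩ := Filter.eventually_prod_self_iff (r := fun x y ↦
    ‖F x - F y - fderiv ℝ F u₀ (x - y)‖ ≤ η * ‖x - y‖) |>.1 hFs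
  obtain ⟨δ, hδ, hball⟩ := Metric.eventually_nhds_iff_ball.1
    (((((hcoer.and hGB).and hGd).and hFd).and hsymm).and hV)
  refine ⟨δ, hδ, fun a b u v hab H ↦ ?_⟩
  refine le_exp_mul_of_deriv_le
    (f := fun t ↦ G (u t) (v t - u t) (v t - u t))
    (f' := fun t ↦ fderiv ℝ G (u t) (F (u t)) (v t - u t) (v t - u t)
      + G (u t) (F (v t) - F (u t)) (v t - u t) + G (u t) (v t - u t) (F (v t) - F (u t)))
    (K := 2 * (C + ε)) hab ?_ ?_
  · intro t ht
    obtain ⟨hu, hv, hu', hv', -⟩ := H t ht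
    obtain ⟨⟨⟨⟨⟨-, -⟩, hd⟩, -⟩, -⟩, -⟩ := hball _ hu
    have h1 : HasDerivAt (fun t ↦ G (u t)) (fderiv ℝ G (u t) (F (u t))) t :=
      hd.hasFDerivAt.comp_hasDerivAt t hu'
    exact (h1.clm_apply (hv'.sub hu')).clm_apply (hv'.sub hu')
  · intro t ht
    obtain ⟨hu, hv, -, -, hC⟩ := H t ht
    obtain ⟨⟨⟨⟨⟨hc, hb⟩, -⟩, hf⟩, hs⟩, hu1⟩ := hball _ hu
    obtain ⟨-, hv1⟩ := hball _ hv
    set w := v t - u t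
    have h1 : ‖F (v t) - F (u t) - fderiv ℝ F (u t) w‖ ≤ 2 * η * ‖w‖ := by
      have e : F (v t) - F (u t) - fderiv ℝ F (u t) w =
          (F (v t) - F (u t) - fderiv ℝ F u₀ w) - (fderiv ℝ F (u t) - fderiv ℝ F u₀) w := by
        simp only [sub_apply]; abel
      rw [e]
      calc _ ≤ ‖F (v t) - F (u t) - fderiv ℝ F u₀ w‖
            + ‖(fderiv ℝ F (u t) - fderiv ℝ F u₀) w‖ := norm_sub_le _ _
        _ ≤ η * ‖w‖ + η * ‖w‖ := by
          gcongr
          · exact hFV _ hv1 _ hu1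
          · exact (ContinuousLinearMap.le_opNorm _ _).trans (by gcongr)
        _ = _ := by ring
    have h2 : G (u t) (F (v t) - F (u t)) w - G (u t) (fderiv ℝ F (u t) w) w
        ≤ ε * m * ‖w‖ ^ 2 := by
      calc _ = G (u t) (F (v t) - F (u t) - fderiv ℝ F (u t) w) w := by simp
        _ ≤ ‖G (u t) (F (v t) - F (u t) - fderiv ℝ F (u t) w) w‖ := Real.le_norm_self _
        _ ≤ ‖G (u t)‖ * ‖F (v t) - F (u t) - fderiv ℝ F (u t) w‖ * ‖w‖ :=
          (G (u t)).le_opNorm₂ _ _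
        _ ≤ B * (2 * η * ‖w‖) * ‖w‖ := by gcongr
        _ = _ := by simp only [η]; field_simp
    rw [hs w]
    nlinarith [hC w, hc w]

end Analysis

section Frame

variable {E : Type*} [NormedAddCommGroup E] [NormedSpace ℝ E]
  {M : Type*} [TopologicalSpace M] [ChartedSpace E M] [IsManifold 𝓘(ℝ, E) ∞ M]

/-- The coordinate frame of the chart at `x₀`, as a linear map from the model space to the tangent
space at `x`. -/
def frameMap (x₀ x : M) : E →L[ℝ] TangentSpace 𝓘(ℝ, E) x :=
  (trivializationAt E (fun x : M ↦ TangentSpace 𝓘(ℝ, E) x) x₀).symmL ℝ x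

/-- The coordinates of a tangent vector at `x` in the chart at `x₀`. -/
def coframeMap (x₀ x : M) : TangentSpace 𝓘(ℝ, E) x →L[ℝ] E :=
  (trivializationAt E (fun x : M ↦ TangentSpace 𝓘(ℝ, E) x) x₀).continuousLinearMapAt ℝ x

variable {x₀ x : M}

theorem frameMap_coframeMap (hx : x ∈ (chartAt E x₀).source) (v : TangentSpace 𝓘(ℝ, E) x) :
    frameMap x₀ x (coframeMap x₀ x v) = v :=
  (trivializationAt E (fun x : M ↦ TangentSpace 𝓘(ℝ, E) x) x₀).symmL_continuousLinearMapAt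
    (R := ℝ) hx v

theorem coframeMap_frameMap (hx : x ∈ (chartAt E x₀).source) (v : E) :
    coframeMap x₀ x (frameMap x₀ x v) = v :=
  (trivializationAt E (fun x : M ↦ TangentSpace 𝓘(ℝ, E) x) x₀).continuousLinearMapAt_symmL
    (R := ℝ) hx v

theorem hasMFDerivAt_extChartAt_coframeMap (hx : x ∈ (chartAt E x₀).source) :
    HasMFDerivAt 𝓘(ℝ, E) 𝓘(ℝ, E) (extChartAt 𝓘(ℝ, E) x₀) x (coframeMap x₀ x) := by
  rw [coframeMap, TangentBundle.continuousLinearMapAt_trivializationAt hx]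
  exact (mdifferentiableAt_extChartAt hx).hasMFDerivAt

theorem symm_mem_chart_source {u : E} (hu : u ∈ (extChartAt 𝓘(ℝ, E) x₀).target) :
    (extChartAt 𝓘(ℝ, E) x₀).symm u ∈ (chartAt E x₀).source := by
  simpa using (extChartAt 𝓘(ℝ, E) x₀).map_target hu

theorem hasMFDerivAt_extChartAt_symm_frameMap {u : E}
    (hu : u ∈ (extChartAt 𝓘(ℝ, E) x₀).target) :
    HasMFDerivAt 𝓘(ℝ, E) 𝓘(ℝ, E) (extChartAt 𝓘(ℝ, E) x₀).symm u
      (frameMap (E := E) x₀ ((extChartAt 𝓘(ℝ, E) x₀).symm u)) := by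
  have h := (mdifferentiableWithinAt_extChartAt_symm (I := 𝓘(ℝ, E)) hu).hasMFDerivWithinAt
  rw [frameMap, TangentBundle.symmL_trivializationAt (symm_mem_chart_source hu),
    (extChartAt 𝓘(ℝ, E) x₀).right_inv hu]
  simpa only [modelWithCornersSelf_coe, range_id, hasMFDerivWithinAt_univ] using! h

theorem frameMap_eq_inverse (hx : x ∈ (chartAt E x₀).source) (v : E) :
    frameMap x₀ x v = (mfderiv 𝓘(ℝ, E) 𝓘(ℝ, E) (extChartAt 𝓘(ℝ, E) x₀) x).inverse v := by
  rw [(hasMFDerivAt_extChartAt_coframeMap hx).mfderiv]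
  have : (coframeMap x₀ x).inverse = frameMap x₀ x := ContinuousLinearMap.inverse_eq
    (ContinuousLinearMap.ext fun v ↦ coframeMap_frameMap hx v)
    (ContinuousLinearMap.ext fun v ↦ frameMap_coframeMap hx v)
  exact congr($this v).symm

theorem contMDiffAt_frameMap (hx : x ∈ (chartAt E x₀).source) (v : E) :
    ContMDiffAt 𝓘(ℝ, E) (𝓘(ℝ, E)).tangent ∞
      (fun y ↦ (⟨y, frameMap x₀ y v⟩ : TangentBundle 𝓘(ℝ, E) M)) x := by
  have hs : (chartAt E x₀).source ∈ 𝓝 x := (chartAt E x₀).open_source.mem_nhds hx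
  refine ((trivializationAt E (fun x : M ↦ TangentSpace 𝓘(ℝ, E) x) x₀).contMDiffAt_section_iff
    (IB := 𝓘(ℝ, E)) (s := fun y ↦ frameMap x₀ y v) hx).2 ?_
  refine (contMDiffAt_const (c := v)).congr_of_eventuallyEq ?_
  filter_upwards [hs] with y hy
  have := coframeMap_frameMap hy v
  rwa [coframeMap, Trivialization.continuousLinearMapAt_apply,
    Trivialization.coe_linearMapAt_of_mem _ hy] at this

/-- The coordinates of the vector field `X` in the chart at `x₀`. -/
def chartField (X : Π x : M, TangentSpace 𝓘(ℝ, E) x) (x₀ : M) (u : E) : E :=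
  coframeMap x₀ ((extChartAt 𝓘(ℝ, E) x₀).symm u) (X ((extChartAt 𝓘(ℝ, E) x₀).symm u))

variable {X : Π x : M, TangentSpace 𝓘(ℝ, E) x}

theorem chartField_extChartAt (hx : x ∈ (chartAt E x₀).source) :
    chartField X x₀ (extChartAt 𝓘(ℝ, E) x₀ x) = coframeMap x₀ x (X x) := by
  rw [chartField, (extChartAt 𝓘(ℝ, E) x₀).left_inv (by simpa using hx)]

theorem contDiffOn_chartField
    (hX : ContMDiff 𝓘(ℝ, E) (𝓘(ℝ, E)).tangent ∞
      (fun x : M ↦ (⟨x, X x⟩ : TangentBundle 𝓘(ℝ, E) M))) :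
    ContDiffOn ℝ ∞ (chartField X x₀) (extChartAt 𝓘(ℝ, E) x₀).target := by
  rw [← contMDiffOn_iff_contDiffOn]
  intro u hu
  have h1 := ((trivializationAt E (fun x : M ↦ TangentSpace 𝓘(ℝ, E) x) x₀).contMDiffAt_section_iff
    (IB := 𝓘(ℝ, E)) (s := X) (symm_mem_chart_source hu)).1 hX.contMDiffAt
  refine (h1.comp_contMDiffWithinAt u (contMDiffOn_extChartAt_symm x₀ u hu)).congr ?_ ?_
  · intro w hw
    rw [chartField, coframeMap, Trivialization.continuousLinearMapAt_apply,
      Trivialization.coe_linearMapAt_of_mem _ (symm_mem_chart_source hw)]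
    rfl
  · rw [chartField, coframeMap, Trivialization.continuousLinearMapAt_apply,
      Trivialization.coe_linearMapAt_of_mem _ (symm_mem_chart_source hu)]
    rfl

variable [FiniteDimensional ℝ E]
  [RiemannianBundle (fun x : M ↦ TangentSpace 𝓘(ℝ, E) x)]
  [IsContMDiffRiemannianBundle 𝓘(ℝ, E) ∞ E (fun x : M ↦ TangentSpace 𝓘(ℝ, E) x)]

/-- The metric at the point `x` in the chart at `x₀`. -/
def frameMetric (x₀ x : M) : E →L[ℝ] E →L[ℝ] ℝ :=
  (innerSL ℝ (E := TangentSpace 𝓘(ℝ, E) x)).bilinearComp (frameMap x₀ x) (frameMap x₀ x)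

/-- The metric in the chart at `x₀`. -/
def chartMetric (x₀ : M) (u : E) : E →L[ℝ] E →L[ℝ] ℝ :=
  frameMetric x₀ ((extChartAt 𝓘(ℝ, E) x₀).symm u)

theorem frameMetric_apply (v w : E) :
    frameMetric x₀ x v w = inner ℝ (frameMap x₀ x v) (frameMap x₀ x w) := rfl

theorem chartMetric_extChartAt (hx : x ∈ (chartAt E x₀).source) :
    chartMetric x₀ (extChartAt 𝓘(ℝ, E) x₀ x) = frameMetric x₀ x := by
  rw [chartMetric, (extChartAt 𝓘(ℝ, E) x₀).left_inv (by simpa using hx)]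

theorem frameMetric_self (v : E) : frameMetric x₀ x v v = ‖frameMap x₀ x v‖ ^ 2 := by
  rw [frameMetric_apply, real_inner_self_eq_norm_sq]

theorem frameMetric_symm (v w : E) : frameMetric x₀ x v w = frameMetric x₀ x w v := by
  rw [frameMetric_apply, frameMetric_apply, real_inner_comm]

theorem frameMetric_pos (hx : x ∈ (chartAt E x₀).source) {v : E} (hv : v ≠ 0) :
    0 < frameMetric x₀ x v v := by
  rw [frameMetric_self]
  have : frameMap x₀ x v ≠ 0 := fun h ↦ hv (by rw [← coframeMap_frameMap hx v, h, map_zero])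
  have := norm_pos_iff.2 this
  positivity

theorem contDiffOn_chartMetric :
    ContDiffOn ℝ ∞ (chartMetric (M := M) x₀) (extChartAt 𝓘(ℝ, E) x₀).target := by
  rw [contDiffOn_clm_apply]
  intro v
  rw [contDiffOn_clm_apply]
  intro w
  rw [← contMDiffOn_iff_contDiffOn]
  intro u hu
  have h1 := ContMDiffAt.inner_bundle (IB := 𝓘(ℝ, E)) (n := ∞) (F := E)
    (E := fun x : M ↦ TangentSpace 𝓘(ℝ, E) x) (b := fun y ↦ y)
    (contMDiffAt_frameMap (symm_mem_chart_source hu) v)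
    (contMDiffAt_frameMap (symm_mem_chart_source hu) w)
  exact h1.comp_contMDiffWithinAt u (contMDiffOn_extChartAt_symm x₀ u hu)

end Frame

section LeviCivitaChart

variable {E : Type*} [NormedAddCommGroup E] [NormedSpace ℝ E] [FiniteDimensional ℝ E]
  {M : Type*} [TopologicalSpace M] [ChartedSpace E M] [IsManifold 𝓘(ℝ, E) ∞ M]
  {x₀ x : M} {X : Π x : M, TangentSpace 𝓘(ℝ, E) x}

theorem mvfderiv_eq_fderiv_chart {f : M → ℝ} {h : E → ℝ} (hx : x ∈ (chartAt E x₀).source)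
    (hh : DifferentiableAt ℝ h (extChartAt 𝓘(ℝ, E) x₀ x))
    (hf : ∀ y ∈ (chartAt E x₀).source, f y = h (extChartAt 𝓘(ℝ, E) x₀ y))
    (ξ : TangentSpace 𝓘(ℝ, E) x) :
    mvfderiv 𝓘(ℝ, E) f x ξ = fderiv ℝ h (extChartAt 𝓘(ℝ, E) x₀ x) (coframeMap x₀ x ξ) := by
  have h1 := hh.hasFDerivAt.hasMFDerivAt.comp x (hasMFDerivAt_extChartAt_coframeMap hx)
  have h2 := h1.congr_of_eventuallyEq (f₁ := f)
    (Filter.eventually_of_mem ((chartAt E x₀).open_source.mem_nhds hx) hf)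
  rw [mvfderiv, h2.mfderiv]
  rfl

theorem lieBracket_const_left (v : E) (F : E → E) (u : E) :
    VectorField.lieBracketWithin ℝ (fun _ : E ↦ v) F univ u = fderiv ℝ F u v := by
  simp [VectorField.lieBracketWithin]

theorem mlieBracket_const_left (v : E) (F : Π u : E, TangentSpace 𝓘(ℝ, E) u) (u : E) :
    VectorField.mlieBracket 𝓘(ℝ, E) (fun _ : E ↦ v) F u = fderiv ℝ (F : E → E) u v :=
  (congrFun (VectorField.mlieBracketWithin_eq_lieBracketWithin (s := univ)) u).trans
    (lieBracket_const_left v F u)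

theorem mlieBracket_frameMap_mpullback (hx : x ∈ (chartAt E x₀).source) (v : E) {F : E → E}
    (hF : ContDiffAt ℝ 1 F (extChartAt 𝓘(ℝ, E) x₀ x))
    (hX : ∀ y ∈ (chartAt E x₀).source, X y = frameMap x₀ y (F (extChartAt 𝓘(ℝ, E) x₀ y))) :
    VectorField.mlieBracket 𝓘(ℝ, E) (fun y ↦ frameMap x₀ y v) X x
      = frameMap x₀ x (fderiv ℝ F (extChartAt 𝓘(ℝ, E) x₀ x) v) := by
  have hs : (chartAt E x₀).source ∈ 𝓝 x := (chartAt E x₀).open_source.mem_nhds hx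
  have h1 : (fun y : M ↦ frameMap x₀ y v) =ᶠ[𝓝 x] VectorField.mpullback 𝓘(ℝ, E) 𝓘(ℝ, E)
      (extChartAt 𝓘(ℝ, E) x₀) (fun _ ↦ v) := by
    filter_upwards [hs] with y hy using frameMap_eq_inverse hy v
  have h2 : X =ᶠ[𝓝 x] VectorField.mpullback 𝓘(ℝ, E) 𝓘(ℝ, E) (extChartAt 𝓘(ℝ, E) x₀) F := by
    filter_upwards [hs] with y hy
    rw [hX y hy, frameMap_eq_inverse hy]
    rfl
  have hc : CompleteSpace E := FiniteDimensional.complete ℝ E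
  have hm : IsManifold 𝓘(ℝ, E) (minSmoothness ℝ 2) M := by
    rw [minSmoothness_of_isRCLikeNormedField]; infer_instance
  have hm' : IsManifold 𝓘(ℝ, E) (minSmoothness ℝ 2) E := by infer_instance
  rw [h1.mlieBracket_vectorField_eq h2,
    ← VectorField.mpullback_mlieBracket (n := 2)
      ((contMDiffAt_vectorSpace_iff_contDiffAt (n := 1) |>.2 contDiffAt_const).mdifferentiableAt
        one_ne_zero)
      ((contMDiffAt_vectorSpace_iff_contDiffAt.2 hF).mdifferentiableAt one_ne_zero)
      (contMDiffAt_extChartAt' hx) (by simp), frameMap_eq_inverse hx]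
  refine congrArg (mfderiv 𝓘(ℝ, E) 𝓘(ℝ, E) (extChartAt 𝓘(ℝ, E) x₀) x).inverse
    (mlieBracket_const_left v F _)

variable
  [RiemannianBundle (fun x : M ↦ TangentSpace 𝓘(ℝ, E) x)]
  [IsContMDiffRiemannianBundle 𝓘(ℝ, E) ∞ E (fun x : M ↦ TangentSpace 𝓘(ℝ, E) x)]

theorem inner_leviCivita_frameMap
    (hX : ContMDiff 𝓘(ℝ, E) (𝓘(ℝ, E)).tangent ∞
      (fun x : M ↦ (⟨x, X x⟩ : TangentBundle 𝓘(ℝ, E) M)))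
    (hx : x ∈ (chartAt E x₀).source) {u : E} (hu : extChartAt 𝓘(ℝ, E) x₀ x = u) (v w : E) :
    inner ℝ (leviCivita 𝓘(ℝ, E) M X x (frameMap x₀ x v)) (frameMap x₀ x w) =
      (1 / 2 : ℝ) * (fderiv ℝ (chartMetric (M := M) x₀) u v (chartField X x₀ u) w
        + fderiv ℝ (chartMetric (M := M) x₀) u (chartField X x₀ u) w v
        - fderiv ℝ (chartMetric (M := M) x₀) u w v (chartField X x₀ u))
      + chartMetric (M := M) x₀ u (fderiv ℝ (chartField X x₀) u v) w := by
  subst hu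
  set u := extChartAt 𝓘(ℝ, E) x₀ x with hu
  have hut : u ∈ (extChartAt 𝓘(ℝ, E) x₀).target :=
    (extChartAt 𝓘(ℝ, E) x₀).map_source (by simpa using hx)
  have hnhds : (extChartAt 𝓘(ℝ, E) x₀).target ∈ 𝓝 u :=
    (isOpen_extChartAt_target x₀).mem_nhds hut
  have hG : DifferentiableAt ℝ (chartMetric (M := M) x₀) u :=
    ((contDiffOn_chartMetric u hut).contDiffAt hnhds).differentiableAt (by simp)
  have hF1 : ContDiffAt ℝ 1 (chartField X x₀) u :=
    ((contDiffOn_chartField hX u hut).contDiffAt hnhds).of_le (by simp)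
  have hF : DifferentiableAt ℝ (chartField X x₀) u := hF1.differentiableAt one_ne_zero
  have hXF (y : M) (hy : y ∈ (chartAt E x₀).source) :
      X y = frameMap x₀ y (chartField X x₀ (extChartAt 𝓘(ℝ, E) x₀ y)) := by
    rw [chartField_extChartAt hy, frameMap_coframeMap hy]
  have hfr (v : E) : MDiffAt (T% (fun y : M ↦ frameMap x₀ y v)) x :=
    (contMDiffAt_frameMap hx v).mdifferentiableAt (by simp)
  have hXd : MDiffAt (T% X) x := (hX x).mdifferentiableAt (by simp)
  have hin (y : M) (hy : y ∈ (chartAt E x₀).source) (a b : E) :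
      inner ℝ (frameMap x₀ y a) (frameMap x₀ y b)
        = chartMetric (M := M) x₀ (extChartAt 𝓘(ℝ, E) x₀ y) a b := by
    rw [chartMetric_extChartAt hy, frameMetric_apply]
  have hGv (a b : E → E) (ha : DifferentiableAt ℝ a u) (hb : DifferentiableAt ℝ b u) (z : E) :
      fderiv ℝ (fun p ↦ chartMetric (M := M) x₀ p (a p) (b p)) u z
        = fderiv ℝ (chartMetric (M := M) x₀) u z (a u) (b u)
          + chartMetric (M := M) x₀ u (fderiv ℝ a u z) (b u)
          + chartMetric (M := M) x₀ u (a u) (fderiv ℝ b u z) := by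
    have := (hG.hasFDerivAt.clm_apply ha.hasFDerivAt).clm_apply hb.hasFDerivAt
    rw [this.fderiv]
    simp
    ring
  have hGd (a b : E → E) (ha : DifferentiableAt ℝ a u) (hb : DifferentiableAt ℝ b u) :
      DifferentiableAt ℝ (fun p ↦ chartMetric (M := M) x₀ p (a p) (b p)) u :=
    (hG.clm_apply ha).clm_apply hb
  have hcs (v : E) : DifferentiableAt ℝ (fun _ : E ↦ v) u := differentiableAt_const v
  rw [inner_leviCivita hXd (hfr v) (hfr w), koszul,
    mvfderiv_eq_fderiv_chart (h := fun p ↦ chartMetric (M := M) x₀ p (chartField X x₀ p) w) hx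
      (hGd _ _ hF (hcs w)) (fun y hy ↦ by rw [← hin y hy, ← hXF y hy]),
    mvfderiv_eq_fderiv_chart (h := fun p ↦ chartMetric (M := M) x₀ p w v) hx
      (hGd _ _ (hcs w) (hcs v)) (fun y hy ↦ by rw [← hin y hy]),
    mvfderiv_eq_fderiv_chart (h := fun p ↦ chartMetric (M := M) x₀ p v (chartField X x₀ p)) hx
      (hGd _ _ (hcs v) hF) (fun y hy ↦ by rw [← hin y hy, ← hXF y hy]),
    VectorField.mlieBracket_swap_apply (V := X), mlieBracket_frameMap_mpullback hx v hF1 hXF,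
    mlieBracket_frameMap_mpullback hx w hF1 hXF,
    mlieBracket_frameMap_mpullback (F := fun _ ↦ v) hx w contDiffAt_const (fun _ _ ↦ rfl)]
  rw [hGv _ _ hF (hcs w), hGv _ _ (hcs w) (hcs v), hGv _ _ (hcs v) hF, inner_neg_left,
    hin x hx, hin x hx, ← hu, chartField_extChartAt hx, coframeMap_frameMap hx,
    coframeMap_frameMap hx]
  have hsymm : chartMetric (M := M) x₀ u (fderiv ℝ (chartField X x₀) u w) v
      = chartMetric (M := M) x₀ u v (fderiv ℝ (chartField X x₀) u w) := frameMetric_symm _ _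
  simp only [fderiv_fun_const, Pi.zero_apply, zero_apply, map_zero, inner_zero_left, hsymm]
  ring

end LeviCivitaChart

section LocalEstimates

variable {E : Type*} [NormedAddCommGroup E] [NormedSpace ℝ E] [FiniteDimensional ℝ E]
  {M : Type*} [TopologicalSpace M] [ChartedSpace E M] [IsManifold 𝓘(ℝ, E) ∞ M]
  [RiemannianBundle (fun x : M ↦ TangentSpace 𝓘(ℝ, E) x)]
  [IsContMDiffRiemannianBundle 𝓘(ℝ, E) ∞ E (fun x : M ↦ TangentSpace 𝓘(ℝ, E) x)]
  {x₀ x₁ x : M} {X : Π x : M, TangentSpace 𝓘(ℝ, E) x}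

/-- A smooth Riemannian metric is continuous. -/
instance instIsContinuousRiemannianBundle :
    IsContinuousRiemannianBundle E (fun x : M ↦ TangentSpace 𝓘(ℝ, E) x) := by
  obtain ⟨g, hg, h⟩ := IsContMDiffRiemannianBundle.exists_contMDiff (IB := 𝓘(ℝ, E)) (n := ∞)
    (F := E) (E := fun x : M ↦ TangentSpace 𝓘(ℝ, E) x)
  exact ⟨g, hg.continuous, h⟩

theorem extChartAt_mem_target (hx : x ∈ (chartAt E x₀).source) :
    extChartAt 𝓘(ℝ, E) x₀ x ∈ (extChartAt 𝓘(ℝ, E) x₀).target :=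
  (extChartAt 𝓘(ℝ, E) x₀).map_source (by simpa using hx)

theorem contDiffAt_chartMetric {u : E} (hu : u ∈ (extChartAt 𝓘(ℝ, E) x₀).target) :
    ContDiffAt ℝ 1 (chartMetric (M := M) x₀) u :=
  ((contDiffOn_chartMetric u hu).contDiffAt
    ((isOpen_extChartAt_target x₀).mem_nhds hu)).of_le (by simp)

theorem contDiffAt_chartField
    (hX : ContMDiff 𝓘(ℝ, E) (𝓘(ℝ, E)).tangent ∞
      (fun x : M ↦ (⟨x, X x⟩ : TangentBundle 𝓘(ℝ, E) M)))
    {u : E} (hu : u ∈ (extChartAt 𝓘(ℝ, E) x₀).target) :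
    ContDiffAt ℝ 1 (chartField X x₀) u :=
  ((contDiffOn_chartField hX u hu).contDiffAt
    ((isOpen_extChartAt_target x₀).mem_nhds hu)).of_le (by simp)

theorem chartMetric_pos {u : E} (hu : u ∈ (extChartAt 𝓘(ℝ, E) x₀).target) {v : E} (hv : v ≠ 0) :
    0 < chartMetric (M := M) x₀ u v v :=
  frameMetric_pos (symm_mem_chart_source hu) hv

/-- The norm of the covariant differential of a smooth vector field is locally bounded. -/
theorem exists_eventually_norm_leviCivita_le
    (hX : ContMDiff 𝓘(ℝ, E) (𝓘(ℝ, E)).tangent ∞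
      (fun x : M ↦ (⟨x, X x⟩ : TangentBundle 𝓘(ℝ, E) M))) (x₀ : M) :
    ∃ K, ∀ᶠ x in 𝓝 x₀, ‖leviCivita 𝓘(ℝ, E) M X x‖ ≤ K := by
  obtain ⟨c, hc, hcof⟩ : ∃ c > 0, ∀ᶠ y in 𝓝 x₀, ‖coframeMap x₀ y‖ < c :=
    eventually_norm_trivializationAt_lt E (fun x : M ↦ TangentSpace 𝓘(ℝ, E) x) x₀
  have ht : extChartAt 𝓘(ℝ, E) x₀ x₀ ∈ (extChartAt 𝓘(ℝ, E) x₀).target :=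
    extChartAt_mem_target (mem_chart_source E x₀)
  have hG := contDiffAt_chartMetric (M := M) ht
  have hF := contDiffAt_chartField hX ht
  set k : E → ℝ := fun u ↦ 3 / 2 * (‖fderiv ℝ (chartMetric (M := M) x₀) u‖ * ‖chartField X x₀ u‖)
    + ‖chartMetric (M := M) x₀ u‖ * ‖fderiv ℝ (chartField X x₀) u‖ with hk
  have hkc : ContinuousAt k (extChartAt 𝓘(ℝ, E) x₀ x₀) := by
    have h1 := (hG.fderiv_right (m := 0) (by simp)).continuousAt
    have h2 := (hF.fderiv_right (m := 0) (by simp)).continuousAt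
    exact (continuousAt_const.mul (h1.norm.mul hF.continuousAt.norm)).add
      (hG.continuousAt.norm.mul h2.norm)
  set K : ℝ := k (extChartAt 𝓘(ℝ, E) x₀ x₀) + 1
  have hkK : ∀ᶠ y in 𝓝 x₀, k (extChartAt 𝓘(ℝ, E) x₀ y) < K :=
    Filter.Tendsto.eventually_lt_const (f := k ∘ extChartAt 𝓘(ℝ, E) x₀) (lt_add_one _)
      (hkc.comp (continuousAt_extChartAt x₀))
  have hk0 (u : E) : 0 ≤ k u := by positivity
  have hK : 0 ≤ K := by have := hk0 (extChartAt 𝓘(ℝ, E) x₀ x₀); positivity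
  refine ⟨K * c * c, ?_⟩
  filter_upwards [hcof, hkK, chart_source_mem_nhds E x₀] with x hxc hxk hx
  refine ContinuousLinearMap.opNorm_le_bound _ (by positivity) fun a ↦ ?_
  set A := leviCivita 𝓘(ℝ, E) M X x
  set u := extChartAt 𝓘(ℝ, E) x₀ x with hu
  have hb (v w : E) : inner ℝ (A (frameMap x₀ x v)) (frameMap x₀ x w) ≤ K * ‖v‖ * ‖w‖ := by
    rw [inner_leviCivita_frameMap hX hx hu.symm]
    have e (p q r : E) : |fderiv ℝ (chartMetric (M := M) x₀) u p q r|
        ≤ ‖fderiv ℝ (chartMetric (M := M) x₀) u‖ * ‖p‖ * ‖q‖ * ‖r‖ :=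
      ((fderiv ℝ (chartMetric (M := M) x₀) u p).le_opNorm₂ q r).trans (by
        gcongr; exact ContinuousLinearMap.le_opNorm _ _)
    have e1 := (abs_le.1 (e v (chartField X x₀ u) w)).2
    have e2 := (abs_le.1 (e (chartField X x₀ u) w v)).2
    have e3 := (abs_le.1 (e w v (chartField X x₀ u))).1
    have e4 : chartMetric (M := M) x₀ u (fderiv ℝ (chartField X x₀) u v) w
        ≤ ‖chartMetric (M := M) x₀ u‖ * (‖fderiv ℝ (chartField X x₀) u‖ * ‖v‖) * ‖w‖ :=
      (Real.le_norm_self _).trans (((chartMetric (M := M) x₀ u).le_opNorm₂ _ _).trans (by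
        gcongr; exact ContinuousLinearMap.le_opNorm _ _))
    calc _ ≤ k u * ‖v‖ * ‖w‖ := by simp only [hk]; linarith
      _ ≤ _ := by gcongr
  have h1 := hb (coframeMap x₀ x a) (coframeMap x₀ x (A a))
  rw [frameMap_coframeMap hx, frameMap_coframeMap hx, real_inner_self_eq_norm_sq] at h1
  have h2 : ‖A a‖ ^ 2 ≤ K * (c * ‖a‖) * (c * ‖A a‖) := h1.trans (by
    gcongr <;> exact (ContinuousLinearMap.le_opNorm _ _).trans (by gcongr))
  rcases (norm_nonneg (A a)).eq_or_lt with h | h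
  · rw [← h]; positivity
  · refine le_of_mul_le_mul_right ?_ h
    nlinarith

/-- Half the Lie derivative of the metric along `X`, computed in a chart, is bounded by `‖∇X‖`. -/
theorem lieDerivative_chartMetric_le
    (hX : ContMDiff 𝓘(ℝ, E) (𝓘(ℝ, E)).tangent ∞
      (fun x : M ↦ (⟨x, X x⟩ : TangentBundle 𝓘(ℝ, E) M)))
    (hx : x ∈ (chartAt E x₀).source) {C : ℝ} (hC : ‖leviCivita 𝓘(ℝ, E) M X x‖ ≤ C)
    {u : E} (hu : extChartAt 𝓘(ℝ, E) x₀ x = u) (w : E) :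
    fderiv ℝ (chartMetric (M := M) x₀) u (chartField X x₀ u) w w
      + 2 * chartMetric (M := M) x₀ u (fderiv ℝ (chartField X x₀) u w) w
        ≤ 2 * C * chartMetric (M := M) x₀ u w w := by
  have h1 := inner_leviCivita_frameMap hX hx hu w w
  have h2 : inner ℝ (leviCivita 𝓘(ℝ, E) M X x (frameMap x₀ x w)) (frameMap x₀ x w)
      ≤ C * chartMetric (M := M) x₀ u w w := by
    rw [← hu, chartMetric_extChartAt hx, frameMetric_self]
    calc _ ≤ ‖leviCivita 𝓘(ℝ, E) M X x (frameMap x₀ x w)‖ * ‖frameMap x₀ x w‖ :=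
          real_inner_le_norm _ _
      _ ≤ (C * ‖frameMap x₀ x w‖) * ‖frameMap x₀ x w‖ := by
          gcongr
          exact (ContinuousLinearMap.le_opNorm _ _).trans (by gcongr)
      _ = _ := by ring
  have hs (p : E) : fderiv ℝ (chartMetric (M := M) x₀) u w p w
      = fderiv ℝ (chartMetric (M := M) x₀) u w w p := by
    have hd := (contDiffAt_chartMetric (M := M) (hu ▸ extChartAt_mem_target hx :
      u ∈ (extChartAt 𝓘(ℝ, E) x₀).target)).differentiableAt one_ne_zero
    have d (a b : E) : HasFDerivAt (fun u ↦ chartMetric (M := M) x₀ u a b)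
        ((fderiv ℝ (chartMetric (M := M) x₀) u).flip a |>.flip b) u := by
      simpa using (hd.hasFDerivAt.clm_apply (hasFDerivAt_const a u)).clm_apply
        (hasFDerivAt_const b u)
    have := (d p w).unique ((d w p).congr_of_eventuallyEq
      (Filter.Eventually.of_forall fun u ↦ frameMetric_symm p w))
    simpa using congr($this w)
  rw [hs] at h1
  linarith

/-- In a chart, the difference of the coordinates of `z` and `x`, measured with the metric at `x`,
is asymptotically independent of the chart. -/
theorem eventually_norm_frameMap_sub_le (h₀ : x ∈ (chartAt E x₀).source)
    (h₁ : x ∈ (chartAt E x₁).source) {ε : ℝ} (hε : 0 < ε) :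
    ∀ᶠ z in 𝓝 x, ‖frameMap x₁ x (extChartAt 𝓘(ℝ, E) x₁ z - extChartAt 𝓘(ℝ, E) x₁ x)‖
      ≤ (1 + ε) * ‖frameMap x₀ x (extChartAt 𝓘(ℝ, E) x₀ z - extChartAt 𝓘(ℝ, E) x₀ x)‖ := by
  set u := extChartAt 𝓘(ℝ, E) x₀ x with hu
  set T : E →L[ℝ] E := (coframeMap x₁ x).comp (frameMap x₀ x)
  have hd : HasFDerivAt (extChartAt 𝓘(ℝ, E) x₁ ∘ (extChartAt 𝓘(ℝ, E) x₀).symm) T u := by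
    have hux : (extChartAt 𝓘(ℝ, E) x₀).symm u = x :=
      (extChartAt 𝓘(ℝ, E) x₀).left_inv (by simpa using h₀)
    have a := hasMFDerivAt_extChartAt_symm_frameMap (extChartAt_mem_target h₀)
    have b := hasMFDerivAt_extChartAt_coframeMap (x := (extChartAt 𝓘(ℝ, E) x₀).symm u) (x₀ := x₁)
      (by rwa [hux])
    have e : T = (coframeMap x₁ ((extChartAt 𝓘(ℝ, E) x₀).symm u)).comp
      (frameMap (E := E) x₀ ((extChartAt 𝓘(ℝ, E) x₀).symm u)) := by rw [hux]
    rw [e]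
    exact (b.comp u a).hasFDerivAt
  set a : ℝ := ‖frameMap (E := E) x₁ x‖ * ‖coframeMap (E := E) x₀ x‖
  have ha : 0 ≤ a := mul_nonneg (ContinuousLinearMap.opNorm_nonneg _)
    (ContinuousLinearMap.opNorm_nonneg _)
  have hη : 0 < ε / (a + 1) := by positivity
  filter_upwards [(continuousAt_extChartAt' (by simpa using h₀)).eventually
      (hd.isLittleO.def hη),
    (chartAt E x₀).open_source.mem_nhds h₀] with z hz hzs
  simp only [Function.comp_apply] at hz
  rw [(extChartAt 𝓘(ℝ, E) x₀).left_inv (by simpa using hzs),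
    (extChartAt 𝓘(ℝ, E) x₀).left_inv (by simpa using h₀)] at hz
  set w := extChartAt 𝓘(ℝ, E) x₀ z - extChartAt 𝓘(ℝ, E) x₀ x with hw
  set d := extChartAt 𝓘(ℝ, E) x₁ z - extChartAt 𝓘(ℝ, E) x₁ x
  have e1 : frameMap x₁ x d = frameMap x₀ x w + frameMap x₁ x (d - T w) := by
    have : frameMap x₁ x (T w) = frameMap x₀ x w := frameMap_coframeMap h₁ _
    rw [(frameMap x₁ x).map_sub d (T w), this]; abel
  have e2 : ‖w‖ ≤ ‖coframeMap (E := E) x₀ x‖ * ‖frameMap x₀ x w‖ := by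
    conv_lhs => rw [← coframeMap_frameMap h₀ w]
    exact ContinuousLinearMap.le_opNorm _ _
  rw [e1]
  calc _ ≤ ‖frameMap x₀ x w‖ + ‖frameMap x₁ x (d - T w)‖ := norm_add_le _ _
    _ ≤ ‖frameMap x₀ x w‖ + ‖frameMap (E := E) x₁ x‖ * (ε / (a + 1) *
        (‖coframeMap (E := E) x₀ x‖ * ‖frameMap x₀ x w‖)) := by
      gcongr
      refine (ContinuousLinearMap.le_opNorm _ _).trans ?_
      gcongr
      exact hz.trans (by gcongr)
    _ = ‖frameMap x₀ x w‖ + ε * (a / (a + 1)) * ‖frameMap x₀ x w‖ := by simp only [a]; ring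
    _ ≤ ‖frameMap x₀ x w‖ + ε * 1 * ‖frameMap x₀ x w‖ := by
      gcongr
      rw [div_le_one (by positivity)]; linarith
    _ = _ := by ring

/-- The Riemannian distance of `x` to a nearby point `z` is at most the length of the difference of
their coordinates, up to a factor arbitrarily close to `1`. -/
theorem eventually_riemannianEDist_le (hx : x ∈ (chartAt E x₀).source) {ε : ℝ} (hε : 0 < ε) :
    ∀ᶠ z in 𝓝 x, riemannianEDist 𝓘(ℝ, E) x z ≤ ENNReal.ofReal
      ((1 + ε) * ‖frameMap x₀ x (extChartAt 𝓘(ℝ, E) x₀ z - extChartAt 𝓘(ℝ, E) x₀ x)‖) := by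
  set u := extChartAt 𝓘(ℝ, E) x₀ x with hu
  have hut : u ∈ (extChartAt 𝓘(ℝ, E) x₀).target := extChartAt_mem_target hx
  have hux : (extChartAt 𝓘(ℝ, E) x₀).symm u = x :=
    (extChartAt 𝓘(ℝ, E) x₀).left_inv (by simpa using hx)
  obtain ⟨r, hr, hball⟩ := Metric.eventually_nhds_iff_ball.1
    ((eventually_quadratic_le (contDiffAt_chartMetric (M := M) hut).continuousAt
      (fun v hv ↦ chartMetric_pos hut hv) hε).and ((isOpen_extChartAt_target x₀).mem_nhds hut))
  filter_upwards [(continuousAt_extChartAt' (by simpa using hx)).eventually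
      (Metric.ball_mem_nhds u hr), (chartAt E x₀).open_source.mem_nhds hx] with z hz hzs
  set w := extChartAt 𝓘(ℝ, E) x₀ z - u with hw
  set c : ℝ → E := fun t ↦ u + t • w with hc
  have hcb (t : ℝ) (ht : t ∈ Icc (0 : ℝ) 1) : c t ∈ Metric.ball u r := by
    have : dist (c t) u = t * ‖w‖ := by
      simp [hc, dist_eq_norm, norm_smul, abs_of_nonneg ht.1]
    rw [Metric.mem_ball, this]
    have hwr : ‖w‖ < r := by rw [hw, ← dist_eq_norm]; exact hz
    nlinarith [ht.2, norm_nonneg w]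
  have hder (t : ℝ) (ht : t ∈ Icc (0 : ℝ) 1) :
      HasMFDerivAt 𝓘(ℝ, ℝ) 𝓘(ℝ, E) ((extChartAt 𝓘(ℝ, E) x₀).symm ∘ c) t
        ((frameMap (E := E) x₀ ((extChartAt 𝓘(ℝ, E) x₀).symm (c t))).comp
          ((1 : ℝ →L[ℝ] ℝ).smulRight w)) := by
    have h1 : HasDerivAt c w t := by
      simpa [hc] using ((hasDerivAt_id t).smul_const w).const_add u
    exact (hasMFDerivAt_extChartAt_symm_frameMap (hball _ (hcb t ht)).2).comp t
      h1.hasFDerivAt.hasMFDerivAt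
  have hlen : riemannianEDist 𝓘(ℝ, E) x z
      ≤ pathELength 𝓘(ℝ, E) ((extChartAt 𝓘(ℝ, E) x₀).symm ∘ c) 0 1 := by
    refine riemannianEDist_le_pathELength ?_ ?_ ?_ zero_le_one
    · have hcs : ContMDiff 𝓘(ℝ, ℝ) 𝓘(ℝ, E) 1 c :=
        contMDiff_iff_contDiff.2 (contDiff_const.add (contDiff_id.smul contDiff_const))
      exact (contMDiffOn_extChartAt_symm x₀).comp hcs.contMDiffOn
        (fun t ht ↦ (hball _ (hcb t ht)).2)
    · simp only [Function.comp_apply, hc, zero_smul, add_zero, hux]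
    · simp only [Function.comp_apply, hc, one_smul, hw, add_sub_cancel]
      exact (extChartAt 𝓘(ℝ, E) x₀).left_inv (by simpa using hzs)
  refine hlen.trans ?_
  rw [pathELength_eq_lintegral_mfderiv_Icc]
  calc _ ≤ ∫⁻ _ in Icc (0 : ℝ) 1, ENNReal.ofReal ((1 + ε) * ‖frameMap x₀ x w‖) := by
        refine MeasureTheory.setLIntegral_mono' measurableSet_Icc fun t ht ↦ ?_
        rw [(hder t ht).mfderiv]
        have h1 := (hball _ (hcb t ht)).1 w
        rw [hu, chartMetric_extChartAt hx, frameMetric_self] at h1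
        have h2 : ‖frameMap x₀ ((extChartAt 𝓘(ℝ, E) x₀).symm (c t)) w‖ ^ 2
            ≤ (1 + ε) * ‖frameMap x₀ x w‖ ^ 2 := by
          rw [← frameMetric_self]; exact h1
        have h3 : ‖frameMap x₀ ((extChartAt 𝓘(ℝ, E) x₀).symm (c t)) w‖
            ≤ (1 + ε) * ‖frameMap x₀ x w‖ := by
          refine abs_le_of_sq_le_sq' ?_ (by positivity) |>.2
          nlinarith [sq_nonneg ‖frameMap x₀ x w‖]
        have h4 : ((frameMap (E := E) x₀ ((extChartAt 𝓘(ℝ, E) x₀).symm (c t))).comp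
          ((1 : ℝ →L[ℝ] ℝ).smulRight w)) (1 : ℝ)
            = frameMap x₀ ((extChartAt 𝓘(ℝ, E) x₀).symm (c t)) w := by
          rw [ContinuousLinearMap.comp_apply, ContinuousLinearMap.smulRight_apply]
          simp only [one_apply_eq_self, one_smul]
        refine (congrArg (fun v : TangentSpace 𝓘(ℝ, E) ((extChartAt 𝓘(ℝ, E) x₀).symm (c t)) ↦
          ‖v‖ₑ) h4).trans_le ?_
        rw [← ofReal_norm]
        exact ENNReal.ofReal_le_ofReal h3
    _ = _ := by simp

end LocalEstimates

theorem eventually_norm_clm_sub_le {E F : Type*} [NormedAddCommGroup E] [NormedSpace ℝ E]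
    [NormedAddCommGroup F] [NormedSpace ℝ F] (A : E →L[ℝ] F) {f : ℝ → E} {f' : E} {s K : ℝ}
    (hf : HasDerivAt f f' s) (hK : ‖A f'‖ < K) :
    ∀ᶠ r in 𝓝[>] s, ‖A (f r - f s)‖ ≤ K * (r - s) := by
  have h2 := ((A.hasFDerivAt.comp_hasDerivAt s hf).hasDerivWithinAt
    (s := Ioi s)).limsup_norm_slope_le hK
  filter_upwards [h2, self_mem_nhdsWithin] with r hr hrs
  have hpos : 0 < r - s := sub_pos.2 hrs
  rw [Function.comp_apply, Function.comp_apply, ← map_sub, Real.norm_of_nonneg hpos.le,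
    inv_mul_lt_iff₀ hpos] at hr
  exact hr.le.trans_eq (mul_comm _ _)

theorem isMIntegralCurveOn_congr {E : Type*} [NormedAddCommGroup E] [NormedSpace ℝ E]
    {M : Type*} [TopologicalSpace M] [ChartedSpace E M] {X : Π x : M, TangentSpace 𝓘(ℝ, E) x}
    {γ γ' : ℝ → M} {J : Set ℝ} (hγ : IsMIntegralCurveOn γ X J) (h : EqOn γ' γ J) :
    IsMIntegralCurveOn γ' X J := by
  intro t ht
  have h1 := (hγ t ht).congr_of_eventuallyEq (f₁ := γ')
    (Filter.eventually_of_mem self_mem_nhdsWithin h) (h ht)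
  have e : (X (γ t) : E) = X (γ' t) := by rw [h ht]
  exact h1.congr_mfderiv (congrArg (fun v : E ↦ (1 : ℝ →L[ℝ] ℝ).smulRight v) e)

section Curves

variable {E : Type*} [NormedAddCommGroup E] [NormedSpace ℝ E] [FiniteDimensional ℝ E]
  {M : Type*} [TopologicalSpace M] [ChartedSpace E M] [IsManifold 𝓘(ℝ, E) ∞ M]
  {x₀ : M} {X : Π x : M, TangentSpace 𝓘(ℝ, E) x} {γ : ℝ → M} {s : ℝ}

theorem hasDerivAt_extChartAt_comp {L : ℝ →L[ℝ] TangentSpace 𝓘(ℝ, E) (γ s)}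
    (hγ : HasMFDerivAt 𝓘(ℝ, ℝ) 𝓘(ℝ, E) γ s L) (hs : γ s ∈ (chartAt E x₀).source) :
    HasDerivAt (fun t ↦ extChartAt 𝓘(ℝ, E) x₀ (γ t)) (coframeMap x₀ (γ s) (L 1)) s := by
  have h : HasFDerivAt (fun t ↦ extChartAt 𝓘(ℝ, E) x₀ (γ t))
      ((coframeMap x₀ (γ s)).comp L : ℝ →L[ℝ] E) s :=
    ((hasMFDerivAt_extChartAt_coframeMap hs).comp s hγ).hasFDerivAt
  exact h.hasDerivAt

theorem hasDerivAt_extChartAt_integralCurve {a b : ℝ} (hγ : IsMIntegralCurveOn γ X (Ioo a b))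
    (hs : s ∈ Ioo a b) (hx : γ s ∈ (chartAt E x₀).source) :
    HasDerivAt (fun t ↦ extChartAt 𝓘(ℝ, E) x₀ (γ t))
      (chartField X x₀ (extChartAt 𝓘(ℝ, E) x₀ (γ s))) s := by
  rw [chartField_extChartAt hx]
  have h := hasDerivAt_extChartAt_comp ((hγ s hs).hasMFDerivAt (Ioo_mem_nhds hs.1 hs.2)) hx
  rw [ContinuousLinearMap.smulRight_apply, one_apply_eq_self, one_smul] at h
  exact h

theorem isMIntegralCurveOn_extChartAt_symm {c : ℝ → E} {J : Set ℝ}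
    (hc : ∀ t ∈ J, HasDerivAt c (chartField X x₀ (c t)) t)
    (hJ : ∀ t ∈ J, c t ∈ (extChartAt 𝓘(ℝ, E) x₀).target) :
    IsMIntegralCurveOn (fun t ↦ (extChartAt 𝓘(ℝ, E) x₀).symm (c t)) X J := by
  intro t ht
  have h := (hasMFDerivAt_extChartAt_symm_frameMap (hJ t ht)).comp t
    (hc t ht).hasFDerivAt.hasMFDerivAt
  refine HasMFDerivAt.hasMFDerivWithinAt (h.congr_mfderiv ?_)
  refine ContinuousLinearMap.ext fun r ↦ ?_
  refine ((frameMap (E := E) x₀ ((extChartAt 𝓘(ℝ, E) x₀).symm (c t))).map_smul r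
    (chartField X x₀ (c t))).trans ?_
  rw [chartField, frameMap_coframeMap (symm_mem_chart_source (hJ t ht))]
  rfl

variable
  [RiemannianBundle (fun x : M ↦ TangentSpace 𝓘(ℝ, E) x)]
  [IsContMDiffRiemannianBundle 𝓘(ℝ, E) ∞ E (fun x : M ↦ TangentSpace 𝓘(ℝ, E) x)]

theorem eventually_norm_frameMap_curve_le {L : ℝ →L[ℝ] TangentSpace 𝓘(ℝ, E) (γ s)}
    (hγ : HasMFDerivAt 𝓘(ℝ, ℝ) 𝓘(ℝ, E) γ s L) (hs : γ s ∈ (chartAt E x₀).source) {K : ℝ}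
    (hK : ‖L 1‖ < K) :
    ∀ᶠ r in 𝓝[>] s, ‖frameMap x₀ (γ s)
      (extChartAt 𝓘(ℝ, E) x₀ (γ r) - extChartAt 𝓘(ℝ, E) x₀ (γ s))‖ ≤ K * (r - s) := by
  refine @eventually_norm_clm_sub_le E (TangentSpace 𝓘(ℝ, E) (γ s)) _ _ inferInstance inferInstance
    (frameMap x₀ (γ s)) _ _ _ _ (hasDerivAt_extChartAt_comp hγ hs) ?_
  rwa [frameMap_coframeMap hs]

theorem continuousAt_norm_mfderiv (hγ : ContMDiffAt 𝓘(ℝ, ℝ) 𝓘(ℝ, E) ∞ γ s) :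
    ContinuousAt (fun r ↦ ‖mfderiv 𝓘(ℝ, ℝ) 𝓘(ℝ, E) γ r (1 : ℝ)‖) s := by
  set x₀ := γ s with hx₀
  have h1 : ContMDiffAt 𝓘(ℝ, ℝ) 𝓘(ℝ, E) 1 γ s := hγ.of_le (by simp)
  have hsrc : ∀ᶠ r in 𝓝 s, γ r ∈ (chartAt E x₀).source :=
    hγ.continuousAt.eventually (chart_source_mem_nhds E x₀)
  have hev : ∀ᶠ r in 𝓝 s, ContMDiffAt 𝓘(ℝ, ℝ) 𝓘(ℝ, E) 1 γ r :=
    (contMDiffAt_iff_contMDiffAt_nhds (by simp)).1 h1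
  set f : ℝ → E := fun t ↦ extChartAt 𝓘(ℝ, E) x₀ (γ t) with hf
  have hfC : ContDiffAt ℝ 1 f s := by
    rw [← contMDiffAt_iff_contDiffAt]
    exact (contMDiffAt_extChartAt' (mem_chart_source E x₀)).comp s h1
  have hfd : ContinuousAt (deriv f) s := by
    have := (hfC.fderiv_right (m := 0) (by simp)).continuousAt.clm_apply
      (continuousAt_const (y := (1 : ℝ)))
    simpa only [fderiv_apply_one_eq_deriv] using this
  have hG : ContinuousAt (fun r ↦ chartMetric (M := M) x₀ (f r)) s :=
    ContinuousAt.comp (g := chartMetric (M := M) x₀) (f := f) (contDiffAt_chartMetric (M := M)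
      (extChartAt_mem_target (mem_chart_source E x₀))).continuousAt hfC.continuousAt
  have hc : ContinuousAt (fun r ↦ √(chartMetric (M := M) x₀ (f r) (deriv f r) (deriv f r))) s :=
    ((hG.clm_apply hfd).clm_apply hfd).sqrt
  refine hc.congr ?_
  filter_upwards [hsrc, hev] with r hr hr1
  have hd := hasDerivAt_extChartAt_comp (hr1.mdifferentiableAt one_ne_zero).hasMFDerivAt hr
  rw [hd.deriv, hf, chartMetric_extChartAt hr, frameMetric_self, Real.sqrt_sq (norm_nonneg _),
    frameMap_coframeMap hr]
  rfl

end Curves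

section FlowContinuity

variable {E : Type*} [NormedAddCommGroup E] [NormedSpace ℝ E] [FiniteDimensional ℝ E]
  {M : Type*} [TopologicalSpace M] [T2Space M] [ChartedSpace E M] [IsManifold 𝓘(ℝ, E) ∞ M]
  {X : Π x : M, TangentSpace 𝓘(ℝ, E) x}

theorem flow_zero
    (hX : ContMDiff 𝓘(ℝ, E) (𝓘(ℝ, E)).tangent ∞
      (fun x : M ↦ (⟨x, X x⟩ : TangentBundle 𝓘(ℝ, E) M)))
    {p : M} {T : ℝ} (hp : (T, p) ∈ flowDomain X) : flow X 0 p = p := by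
  have : CompleteSpace E := FiniteDimensional.complete ℝ E
  obtain ⟨α, h0, a, b, ha, hb, hα⟩ := hp
  rw [flow_eq (hX.of_le (by simp)) ⟨h0, a, b, ha, ha, hα⟩, h0]

/-- The orbit of a point in the flow domain is an integral curve. -/
theorem exists_integralCurve_flow
    (hX : ContMDiff 𝓘(ℝ, E) (𝓘(ℝ, E)).tangent ∞
      (fun x : M ↦ (⟨x, X x⟩ : TangentBundle 𝓘(ℝ, E) M)))
    {p : M} {T : ℝ} (hp : (T, p) ∈ flowDomain X) :
    ∃ a b : ℝ, 0 ∈ Ioo a b ∧ T ∈ Ioo a b ∧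
      IsMIntegralCurveOn (fun t ↦ flow X t p) X (Ioo a b) := by
  have : CompleteSpace E := FiniteDimensional.complete ℝ E
  obtain ⟨α, h0, a, b, ha, hb, hα⟩ := hp
  have h (t : ℝ) (ht : t ∈ Ioo a b) : flow X t p = α t :=
    flow_eq (hX.of_le (by simp)) ⟨h0, a, b, ha, ht, hα⟩
  exact ⟨a, b, ha, hb, isMIntegralCurveOn_congr hα h⟩

theorem flow_sub_flow
    (hX : ContMDiff 𝓘(ℝ, E) (𝓘(ℝ, E)).tangent ∞
      (fun x : M ↦ (⟨x, X x⟩ : TangentBundle 𝓘(ℝ, E) M)))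
    {p : M} {T : ℝ} (hp : (T, p) ∈ flowDomain X) {t₁ t₂ : ℝ} (h₁ : t₁ ∈ Icc 0 T)
    (h₂ : t₂ ∈ Icc 0 T) : flow X (t₂ - t₁) (flow X t₁ p) = flow X t₂ p := by
  have : CompleteSpace E := FiniteDimensional.complete ℝ E
  obtain ⟨a, b, ha, hb, hα⟩ := exists_integralCurve_flow hX hp
  have hJ : {t : ℝ | t + t₁ ∈ Ioo a b} = Ioo (a - t₁) (b - t₁) := by
    ext t; simp only [mem_ofPred_eq, mem_Ioo]; constructor <;> rintro ⟨_, _⟩ <;>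
      constructor <;> linarith
  have h := hα.comp_add t₁
  rw [flow_eq (γ := (fun t ↦ flow X t p) ∘ (· + t₁)) (hX.of_le (by simp))]
  · simp
  · refine ⟨by simp, a - t₁, b - t₁, ?_, ?_, ?_⟩
    · constructor <;> linarith [ha.1, hb.2, h₁.1, h₁.2]
    · constructor <;> linarith [ha.1, hb.2, h₂.1, h₂.2]
    · rw [← hJ]; exact h

/-- The flow is defined and jointly continuous for short times, locally uniformly. -/
theorem exists_local_flow_continuousOn
    (hX : ContMDiff 𝓘(ℝ, E) (𝓘(ℝ, E)).tangent ∞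
      (fun x : M ↦ (⟨x, X x⟩ : TangentBundle 𝓘(ℝ, E) M))) (x₀ : M) :
    ∃ U : Set M, IsOpen U ∧ x₀ ∈ U ∧ ∃ ε > 0,
      ContinuousOn (Function.uncurry (flow X)) (Ioo (-ε) ε ×ˢ U) := by
  have : CompleteSpace E := FiniteDimensional.complete ℝ E
  set u₀ := extChartAt 𝓘(ℝ, E) x₀ x₀ with hu₀
  have hut : u₀ ∈ (extChartAt 𝓘(ℝ, E) x₀).target := mem_extChartAt_target x₀
  have hF : ContDiffAt ℝ 1 (chartField X x₀) u₀ :=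
    ((contDiffOn_chartField hX u₀ hut).contDiffAt
      ((isOpen_extChartAt_target x₀).mem_nhds hut)).of_le (by simp)
  obtain ⟨ε, hε, a, r, L, K, hr, hpl⟩ := IsPicardLindelof.of_contDiffAt_one hF
  obtain ⟨α, hα, hαc⟩ := (hpl 0).exists_forall_mem_closedBall_eq_hasDerivWithinAt_continuousOn
  have hr' : (0 : ℝ) < r := hr
  have hα0 : α (u₀, 0) = u₀ := (hα u₀ (Metric.mem_closedBall_self hr'.le)).1
  have hαc0 : ContinuousAt α (u₀, 0) := hαc.continuousAt
    (prod_mem_nhds (Metric.closedBall_mem_nhds u₀ hr') (Icc_mem_nhds (by simpa) (by simpa)))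
  have hev : ∀ᶠ z in 𝓝 (u₀, (0 : ℝ)), α z ∈ (extChartAt 𝓘(ℝ, E) x₀).target :=
    hαc0.eventually (by rw [hα0]; exact (isOpen_extChartAt_target x₀).mem_nhds hut)
  obtain ⟨δ, hδ, hball⟩ := Metric.eventually_nhds_iff_ball.1 hev
  set ρ : ℝ := min δ (min ε r)
  have hρ : 0 < ρ := by positivity
  have hρδ : ρ ≤ δ := min_le_left _ _
  have hρε : ρ ≤ ε := (min_le_right _ _).trans (min_le_left _ _)
  have hρr : ρ ≤ r := (min_le_right _ _).trans (min_le_right _ _)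
  have htar (u : E) (hu : u ∈ Metric.ball u₀ ρ) (t : ℝ) (ht : t ∈ Ioo (-ρ) ρ) :
      α (u, t) ∈ (extChartAt 𝓘(ℝ, E) x₀).target := by
    refine hball _ ?_
    rw [← ball_prod_same]
    refine ⟨Metric.ball_subset_ball hρδ hu, ?_⟩
    rw [Metric.mem_ball, Real.dist_eq, sub_zero]
    exact (abs_lt.2 ht).trans_le hρδ
  set U : Set M := (extChartAt 𝓘(ℝ, E) x₀).source ∩ extChartAt 𝓘(ℝ, E) x₀ ⁻¹' Metric.ball u₀ ρ
  have hflow (p : M) (hp : p ∈ U) (t : ℝ) (ht : t ∈ Ioo (-ρ) ρ) :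
      flow X t p = (extChartAt 𝓘(ℝ, E) x₀).symm (α (extChartAt 𝓘(ℝ, E) x₀ p, t)) := by
    have hp1 := hα (extChartAt 𝓘(ℝ, E) x₀ p)
      (Metric.ball_subset_closedBall (Metric.ball_subset_ball hρr hp.2))
    refine flow_eq (γ := fun t ↦ (extChartAt 𝓘(ℝ, E) x₀).symm (α (extChartAt 𝓘(ℝ, E) x₀ p, t)))
      (hX.of_le (by simp)) ⟨?_, -ρ, ρ, by simpa, ht, ?_⟩
    · simp only [hp1.1]
      exact (extChartAt 𝓘(ℝ, E) x₀).left_inv hp.1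
    · refine isMIntegralCurveOn_extChartAt_symm (fun t ht ↦ ?_) (fun t ht ↦ htar _ hp.2 t ht)
      have ht' : t ∈ Ioo (0 - ε) (0 + ε) := ⟨by linarith [ht.1], by linarith [ht.2]⟩
      exact (hp1.2 t (Ioo_subset_Icc_self ht')).hasDerivAt (Icc_mem_nhds ht'.1 ht'.2)
  refine ⟨U, (continuousOn_extChartAt x₀).isOpen_inter_preimage (isOpen_extChartAt_source x₀)
    Metric.isOpen_ball, ⟨mem_extChartAt_source x₀, Metric.mem_ball_self hρ⟩, ρ, hρ, ?_⟩
  have hcont : ContinuousOn (fun z : ℝ × M ↦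
      (extChartAt 𝓘(ℝ, E) x₀).symm (α (extChartAt 𝓘(ℝ, E) x₀ z.2, z.1))) (Ioo (-ρ) ρ ×ˢ U) := by
    refine (continuousOn_extChartAt_symm x₀).comp (hαc.comp ?_ ?_)
      fun z hz ↦ htar _ hz.2.2 _ hz.1
    · exact ((continuousOn_extChartAt x₀).comp continuousOn_snd fun z hz ↦ hz.2.1).prodMk
        continuousOn_fst
    · rintro ⟨t, p⟩ ⟨ht, hp⟩
      exact ⟨Metric.ball_subset_closedBall (Metric.ball_subset_ball hρr hp.2),
        ⟨by linarith [ht.1], by linarith [ht.2]⟩⟩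
  exact hcont.congr fun z hz ↦ hflow z.2 hz.2 z.1 hz.1

/-- The flow is jointly continuous on its domain. -/
theorem continuousOn_flow
    (hX : ContMDiff 𝓘(ℝ, E) (𝓘(ℝ, E)).tangent ∞
      (fun x : M ↦ (⟨x, X x⟩ : TangentBundle 𝓘(ℝ, E) M)))
    {T : ℝ} {S : Set M} (hS : Icc 0 T ×ˢ S ⊆ flowDomain X) :
    ContinuousOn (Function.uncurry (flow X)) (Icc 0 T ×ˢ S) := by
  rintro ⟨t, p⟩ ⟨ht, hp⟩
  have hT : T ∈ Icc 0 T := ⟨ht.1.trans ht.2, le_rfl⟩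
  refine Icc_forward_induction (P := fun t ↦
    ContinuousWithinAt (Function.uncurry (flow X)) (Icc 0 T ×ˢ S) (t, p)) ?_ ?_ t ht
  · obtain ⟨U, hU, hpU, ε, hε, hc⟩ := exists_local_flow_continuousOn hX p
    exact (hc.continuousAt (prod_mem_nhds (Ioo_mem_nhds (by simpa) hε)
      (hU.mem_nhds hpU))).continuousWithinAt
  · intro t₀ ht₀
    obtain ⟨U, hU, hpU, ε, hε, hc⟩ := exists_local_flow_continuousOn hX (flow X t₀ p)
    obtain ⟨a, b, ha, hb, hα⟩ := exists_integralCurve_flow hX (hS (mk_mem_prod hT hp))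
    have hcα : ContinuousAt (fun t ↦ flow X t p) t₀ :=
      hα.continuousOn.continuousAt (Ioo_mem_nhds (ha.1.trans_le ht₀.1) (ht₀.2.trans_lt hb.2))
    obtain ⟨η, hη, hηU⟩ := Metric.eventually_nhds_iff.1 (hcα.eventually (hU.mem_nhds hpU))
    refine ⟨min η (ε / 2), by positivity, fun t₁ ht₁ t₂ ht₂ h₁ h₂ _ hP ↦ ?_⟩
    have h12 : t₂ - t₁ ∈ Ioo (-ε) ε := by
      have e1 := abs_lt.1 (h₁.trans_le (min_le_right _ _))
      have e2 := abs_lt.1 (h₂.trans_le (min_le_right _ _))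
      constructor <;> linarith
    have hfU : flow X t₁ p ∈ U := hηU (h₁.trans_le (min_le_left _ _))
    have hloc : ContinuousAt (Function.uncurry (flow X)) (t₂ - t₁, flow X t₁ p) :=
      hc.continuousAt (prod_mem_nhds (Ioo_mem_nhds h12.1 h12.2) (hU.mem_nhds hfU))
    have h1 : ContinuousWithinAt (fun z : ℝ × M ↦ flow X t₁ z.2) (Icc 0 T ×ˢ S) (t₂, p) := by
      refine ContinuousWithinAt.comp (g := Function.uncurry (flow X)) (f := fun z : ℝ × M ↦
        (t₁, z.2)) (t := Icc 0 T ×ˢ S) hP (by fun_prop) ?_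
      exact fun z hz ↦ ⟨ht₁, hz.2⟩
    have h2 : ContinuousWithinAt (fun z : ℝ × M ↦ (z.1 - t₁, flow X t₁ z.2)) (Icc 0 T ×ˢ S)
        (t₂, p) := by
      refine ContinuousWithinAt.prodMk (by fun_prop) h1
    have h3 := ContinuousAt.comp_continuousWithinAt (g := Function.uncurry (flow X))
      (f := fun z : ℝ × M ↦ (z.1 - t₁, flow X t₁ z.2)) (x := (t₂, p)) hloc h2
    refine h3.congr (fun z hz ↦ ?_) ?_
    · exact (flow_sub_flow hX (hS (mk_mem_prod hT hz.2)) ht₁ hz.1).symm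
    · exact (flow_sub_flow hX (hS (mk_mem_prod hT hp)) ht₁ ht₂).symm

end FlowContinuity

section Propagation

variable {E : Type*} [NormedAddCommGroup E] [NormedSpace ℝ E] [FiniteDimensional ℝ E]
  {M : Type*} [TopologicalSpace M] [ChartedSpace E M] [IsManifold 𝓘(ℝ, E) ∞ M]
  [RiemannianBundle (fun x : M ↦ TangentSpace 𝓘(ℝ, E) x)]
  [IsContMDiffRiemannianBundle 𝓘(ℝ, E) ∞ E (fun x : M ↦ TangentSpace 𝓘(ℝ, E) x)]
  {X : Π x : M, TangentSpace 𝓘(ℝ, E) x} {γ : ℝ → M}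

/-- The length, for the metric at `x`, of the difference of the coordinates of `z` and `x` in the
chart at `x₀`. -/
def chartDeviation (x₀ x z : M) : ℝ :=
  ‖frameMap x₀ x (extChartAt 𝓘(ℝ, E) x₀ z - extChartAt 𝓘(ℝ, E) x₀ x)‖

theorem chartDeviation_nonneg (x₀ x z : M) : 0 ≤ chartDeviation (E := E) x₀ x z := norm_nonneg _

theorem chartMetric_sub_eq_chartDeviation_sq {x₀ x : M} (hx : x ∈ (chartAt E x₀).source) (z : M) :
    chartMetric x₀ (extChartAt 𝓘(ℝ, E) x₀ x)
      (extChartAt 𝓘(ℝ, E) x₀ z - extChartAt 𝓘(ℝ, E) x₀ x)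
      (extChartAt 𝓘(ℝ, E) x₀ z - extChartAt 𝓘(ℝ, E) x₀ x) = chartDeviation (E := E) x₀ x z ^ 2 := by
  rw [chartMetric_extChartAt hx, frameMetric_self]
  rfl

theorem nhdsGT_le_nhdsWithin_Icc {s : ℝ} (hs : s ∈ Ico (0 : ℝ) 1) : 𝓝[>] s ≤ 𝓝[Icc 0 1] s := by
  refine nhdsWithin_le_iff.2 ?_
  filter_upwards [Ioo_mem_nhdsGT hs.2] with r hr using ⟨hs.1.trans hr.1.le, hr.2.le⟩

variable [T2Space M]

/-- Infinitesimal version of the Gronwall estimate: along the flow of `X`, the deviation of nearby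
points of the curve `γ` grows at most at the exponential rate `C + ε`, if `‖∇X‖ ≤ C`. -/
theorem eventually_chartDeviation_flow_le
    (hX : ContMDiff 𝓘(ℝ, E) (𝓘(ℝ, E)).tangent ∞
      (fun x : M ↦ (⟨x, X x⟩ : TangentBundle 𝓘(ℝ, E) M)))
    (hγ : ContinuousOn γ (Icc 0 1)) {T : ℝ} (hS : Icc 0 T ×ˢ (γ '' Icc 0 1) ⊆ flowDomain X)
    {C : ℝ} (hC : ∀ t ∈ Icc 0 T, ∀ r ∈ Icc (0 : ℝ) 1,
      ‖leviCivita 𝓘(ℝ, E) M X (flow X t (γ r))‖ ≤ C)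
    {s : ℝ} (hs : s ∈ Ico (0 : ℝ) 1) {L : ℝ →L[ℝ] TangentSpace 𝓘(ℝ, E) (γ s)}
    (hL : HasMFDerivAt 𝓘(ℝ, ℝ) 𝓘(ℝ, E) γ s L) {ε : ℝ} (hε : 0 < ε) :
    ∀ t ∈ Icc 0 T, ∀ x₁ : M, flow X t (γ s) ∈ (chartAt E x₁).source →
      ∀ K, Real.exp ((C + ε) * t) * ‖L 1‖ < K →
        ∀ᶠ r in 𝓝[>] s,
          chartDeviation (E := E) x₁ (flow X t (γ s)) (flow X t (γ r)) ≤ K * (r - s) := by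
  have hs1 : s ∈ Icc (0 : ℝ) 1 := Ico_subset_Icc_self hs
  have hIcc : ∀ᶠ r in 𝓝[>] s, r ∈ Icc (0 : ℝ) 1 := nhdsGT_le_nhdsWithin_Icc hs self_mem_nhdsWithin
  intro t ht
  have hT : T ∈ Icc 0 T := ⟨ht.1.trans ht.2, le_rfl⟩
  have hdom (r : ℝ) (hr : r ∈ Icc (0 : ℝ) 1) : (T, γ r) ∈ flowDomain X :=
    hS (mk_mem_prod hT (mem_image_of_mem γ hr))
  have hflow : ContinuousOn (fun z : ℝ × ℝ ↦ flow X z.1 (γ z.2)) (Icc 0 T ×ˢ Icc (0 : ℝ) 1) :=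
    (continuousOn_flow hX hS).comp
      (continuousOn_fst.prodMk (hγ.comp continuousOn_snd fun z hz ↦ hz.2))
      fun z hz ↦ ⟨hz.1, mem_image_of_mem γ hz.2⟩
  have hflow' (t : ℝ) (ht : t ∈ Icc 0 T) : ContinuousOn (fun r ↦ flow X t (γ r)) (Icc 0 1) :=
    hflow.comp (f := fun r : ℝ ↦ (t, r)) (by fun_prop) fun r hr ↦ ⟨ht, hr⟩
  refine Icc_forward_induction (P := fun t ↦ ∀ x₁ : M, flow X t (γ s) ∈ (chartAt E x₁).source →
      ∀ K, Real.exp ((C + ε) * t) * ‖L 1‖ < K → ∀ᶠ r in 𝓝[>] s,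
        chartDeviation (E := E) x₁ (flow X t (γ s)) (flow X t (γ r)) ≤ K * (r - s)) ?_ ?_ t ht
  · intro x₁ hx₁ K hK
    rw [flow_zero hX (hdom s hs1)] at hx₁ ⊢
    rw [mul_zero, Real.exp_zero, one_mul] at hK
    filter_upwards [eventually_norm_frameMap_curve_le hL hx₁ hK, hIcc] with r hr hr1
    rw [flow_zero hX (hdom r hr1)]
    exact hr
  · intro t₀ ht₀
    set x₀ := flow X t₀ (γ s) with hx₀
    have hut : extChartAt 𝓘(ℝ, E) x₀ x₀ ∈ (extChartAt 𝓘(ℝ, E) x₀).target := mem_extChartAt_target x₀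
    obtain ⟨δ, hδ, hgron⟩ := exists_ball_metric_gronwall (contDiffAt_chartMetric (M := M) hut)
      (contDiffAt_chartField hX hut) (Filter.Eventually.of_forall fun u v w ↦ frameMetric_symm v w)
      (fun v hv ↦ chartMetric_pos hut hv) C hε
    have hW : ∀ᶠ z in 𝓝 x₀, z ∈ (chartAt E x₀).source ∧
        extChartAt 𝓘(ℝ, E) x₀ z ∈ Metric.ball (extChartAt 𝓘(ℝ, E) x₀ x₀) δ :=
      Filter.Eventually.and (chart_source_mem_nhds E x₀)
        ((continuousAt_extChartAt x₀).eventually (Metric.ball_mem_nhds _ hδ))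
    obtain ⟨η, hη, hηW⟩ := Metric.mem_nhdsWithin_iff.1
      ((hflow (t₀, s) ⟨ht₀, hs1⟩).eventually hW)
    have hnear (t : ℝ) (ht : t ∈ Icc 0 T) (r : ℝ) (hr : r ∈ Icc (0 : ℝ) 1) (h : |t - t₀| < η)
        (h' : |r - s| < η) : flow X t (γ r) ∈ (chartAt E x₀).source ∧
        extChartAt 𝓘(ℝ, E) x₀ (flow X t (γ r)) ∈
          Metric.ball (extChartAt 𝓘(ℝ, E) x₀ x₀) δ := by
      refine hηW (a := (t, r)) ⟨?_, ht, hr⟩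
      rw [Metric.mem_ball, Prod.dist_eq]
      exact max_lt h h'
    refine ⟨η, hη, fun t₁ ht₁ t₂ ht₂ h₁ h₂ h12 hP x₁ hx₁ K hK ↦ ?_⟩
    obtain ⟨K₁, hK₁, hK₁K⟩ := exists_between hK
    have hK₁0 : 0 < K₁ := lt_of_le_of_lt (by positivity) hK₁
    have hss : |s - s| < η := by simpa using hη
    have hsrc₁ := (hnear t₁ ht₁ s hs1 h₁ hss).1
    have hsrc₂ := (hnear t₂ ht₂ s hs1 h₂ hss).1
    have hκ : Real.exp ((C + ε) * t₁) * ‖L 1‖ < Real.exp (-((C + ε) * (t₂ - t₁))) * K₁ := by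
      have e : Real.exp ((C + ε) * t₁)
          = Real.exp (-((C + ε) * (t₂ - t₁))) * Real.exp ((C + ε) * t₂) := by
        rw [← Real.exp_add]; congr 1; ring
      rw [e, mul_assoc]
      gcongr
    have hchange := ((hflow' t₂ ht₂ s hs1).mono_left (nhdsGT_le_nhdsWithin_Icc hs)).eventually
      (eventually_norm_frameMap_sub_le hsrc₂ hx₁ (ε := K / K₁ - 1)
        (by rw [sub_pos, one_lt_div hK₁0]; exact hK₁K))
    filter_upwards [hP x₀ hsrc₁ _ hκ, hIcc, hchange, self_mem_nhdsWithin,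
      nhdsWithin_le_nhds (Metric.ball_mem_nhds s hη)] with r hr hrI hrc hrs hrη
    have hrs' : 0 < r - s := sub_pos.2 hrs
    have hsq : chartDeviation (E := E) x₀ (flow X t₂ (γ s)) (flow X t₂ (γ r)) ^ 2
        ≤ Real.exp (2 * (C + ε) * (t₂ - t₁))
          * chartDeviation (E := E) x₀ (flow X t₁ (γ s)) (flow X t₁ (γ r)) ^ 2 := by
      rw [← chartMetric_sub_eq_chartDeviation_sq hsrc₁,
        ← chartMetric_sub_eq_chartDeviation_sq hsrc₂]
      refine hgron t₁ t₂ (fun t ↦ extChartAt 𝓘(ℝ, E) x₀ (flow X t (γ s)))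
        (fun t ↦ extChartAt 𝓘(ℝ, E) x₀ (flow X t (γ r))) h12 fun t ht ↦ ?_
      have htT : t ∈ Icc 0 T := ⟨ht₁.1.trans ht.1, ht.2.trans ht₂.2⟩
      have htη : |t - t₀| < η := by
        rw [abs_lt] at h₁ h₂ ⊢
        constructor <;> linarith [ht.1, ht.2, h₁.1, h₂.2]
      obtain ⟨hs₁, hs₂⟩ := hnear t htT s hs1 htη hss
      obtain ⟨hr₁, hr₂⟩ := hnear t htT r hrI htη hrη
      obtain ⟨a, b, ha, hb, hα⟩ := exists_integralCurve_flow hX (hdom s hs1)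
      obtain ⟨a', b', ha', hb', hα'⟩ := exists_integralCurve_flow hX (hdom r hrI)
      refine ⟨hs₂, hr₂,
        hasDerivAt_extChartAt_integralCurve hα ⟨ha.1.trans_le htT.1, htT.2.trans_lt hb.2⟩ hs₁,
        hasDerivAt_extChartAt_integralCurve hα' ⟨ha'.1.trans_le htT.1, htT.2.trans_lt hb'.2⟩ hr₁,
        fun w ↦ lieDerivative_chartMetric_le hX hs₁ (hC t htT s hs1) rfl w⟩
    have hle : chartDeviation (E := E) x₀ (flow X t₂ (γ s)) (flow X t₂ (γ r)) ≤ K₁ * (r - s) := by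
      have e : Real.exp (2 * (C + ε) * (t₂ - t₁)) = Real.exp ((C + ε) * (t₂ - t₁)) ^ 2 := by
        rw [← Real.exp_nat_mul]; congr 1; push_cast; ring
      rw [e, ← mul_pow] at hsq
      have h3 := abs_le_of_sq_le_sq hsq (mul_nonneg (Real.exp_pos _).le
        (chartDeviation_nonneg _ _ _))
      calc _ ≤ Real.exp ((C + ε) * (t₂ - t₁))
            * chartDeviation (E := E) x₀ (flow X t₁ (γ s)) (flow X t₁ (γ r)) :=
            (le_abs_self _).trans h3
        _ ≤ Real.exp ((C + ε) * (t₂ - t₁))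
            * (Real.exp (-((C + ε) * (t₂ - t₁))) * K₁ * (r - s)) := by gcongr
        _ = _ := by
          rw [← mul_assoc, ← mul_assoc, ← Real.exp_add, add_neg_cancel, Real.exp_zero, one_mul]
    calc _ ≤ (1 + (K / K₁ - 1))
          * chartDeviation (E := E) x₀ (flow X t₂ (γ s)) (flow X t₂ (γ r)) := hrc
      _ ≤ (1 + (K / K₁ - 1)) * (K₁ * (r - s)) := by
          gcongr
          have : 0 < K := hK₁0.trans hK₁K
          have : 0 < K / K₁ := by positivity
          linarith
      _ = K * (r - s) := by field_simp; ring

theorem eventually_riemannianEDist_flow_le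
    (hX : ContMDiff 𝓘(ℝ, E) (𝓘(ℝ, E)).tangent ∞
      (fun x : M ↦ (⟨x, X x⟩ : TangentBundle 𝓘(ℝ, E) M)))
    (hγ : ContinuousOn γ (Icc 0 1)) {T : ℝ} (hS : Icc 0 T ×ˢ (γ '' Icc 0 1) ⊆ flowDomain X)
    {C : ℝ} (hC : ∀ t ∈ Icc 0 T, ∀ r ∈ Icc (0 : ℝ) 1,
      ‖leviCivita 𝓘(ℝ, E) M X (flow X t (γ r))‖ ≤ C)
    {s : ℝ} (hs : s ∈ Ico (0 : ℝ) 1) {L : ℝ →L[ℝ] TangentSpace 𝓘(ℝ, E) (γ s)}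
    (hL : HasMFDerivAt 𝓘(ℝ, ℝ) 𝓘(ℝ, E) γ s L) {ε : ℝ} (hε : 0 < ε) {t : ℝ} (ht : t ∈ Icc 0 T)
    {K : ℝ} (hK : Real.exp ((C + ε) * t) * ‖L 1‖ < K) :
    ∀ᶠ r in 𝓝[>] s, riemannianEDist 𝓘(ℝ, E) (flow X t (γ s)) (flow X t (γ r))
      ≤ ENNReal.ofReal (K * (r - s)) := by
  obtain ⟨K₁, hK₁, hK₁K⟩ := exists_between hK
  have hK₁0 : 0 < K₁ := lt_of_le_of_lt (by positivity) hK₁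
  have hsrc := mem_chart_source E (flow X t (γ s))
  have hc : ContinuousOn (fun r ↦ flow X t (γ r)) (Icc 0 1) :=
    (continuousOn_flow hX hS).comp (f := fun r : ℝ ↦ (t, γ r)) (continuousOn_const.prodMk hγ)
      fun r hr ↦ ⟨ht, mem_image_of_mem γ hr⟩
  have hdist := ((hc s (Ico_subset_Icc_self hs)).mono_left
    (nhdsGT_le_nhdsWithin_Icc hs)).eventually (eventually_riemannianEDist_le hsrc
      (ε := K / K₁ - 1) (by rw [sub_pos, one_lt_div hK₁0]; exact hK₁K))
  filter_upwards [hdist, eventually_chartDeviation_flow_le hX hγ hS hC hs hL hε t ht _ hsrc K₁ hK₁]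
    with r hr hr'
  refine hr.trans (ENNReal.ofReal_le_ofReal ?_)
  calc _ ≤ (1 + (K / K₁ - 1)) * (K₁ * (r - s)) := by
        refine mul_le_mul_of_nonneg_left hr' ?_
        have : 0 < K / K₁ := div_pos (hK₁0.trans hK₁K) hK₁0
        linarith
    _ = K * (r - s) := by field_simp; ring

end Propagation

section Length

variable {E : Type*} [NormedAddCommGroup E] [NormedSpace ℝ E] [FiniteDimensional ℝ E]
  {M : Type*} [TopologicalSpace M] [ChartedSpace E M] [IsManifold 𝓘(ℝ, E) ∞ M]
  [RiemannianBundle (fun x : M ↦ TangentSpace 𝓘(ℝ, E) x)]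
  [IsContMDiffRiemannianBundle 𝓘(ℝ, E) ∞ E (fun x : M ↦ TangentSpace 𝓘(ℝ, E) x)]
  {X : Π x : M, TangentSpace 𝓘(ℝ, E) x} {γ c : ℝ → M}

/-- The Riemannian distance to the starting point of a continuous curve is finite. -/
theorem riemannianEDist_ne_top_of_continuousOn (hc : ContinuousOn c (Icc 0 1)) :
    ∀ r ∈ Icc (0 : ℝ) 1, riemannianEDist 𝓘(ℝ, E) (c 0) (c r) ≠ ⊤ := by
  refine Icc_forward_induction (by simp [riemannianEDist_self]) fun s hs ↦ ?_
  obtain ⟨η, hη, h⟩ := Metric.mem_nhdsWithin_iff.1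
    ((hc s hs).eventually (eventually_riemannianEDist_lt 𝓘(ℝ, E) (c s) one_pos))
  refine ⟨η, hη, fun r₁ hr₁ r₂ hr₂ h₁ h₂ _ hr ↦ ?_⟩
  have e₁ : riemannianEDist 𝓘(ℝ, E) (c s) (c r₁) < 1 := h (a := r₁) ⟨h₁, hr₁⟩
  have e₂ : riemannianEDist 𝓘(ℝ, E) (c s) (c r₂) < 1 := h (a := r₂) ⟨h₂, hr₂⟩
  refine ne_top_of_le_ne_top (b := riemannianEDist 𝓘(ℝ, E) (c 0) (c r₁)
    + (riemannianEDist 𝓘(ℝ, E) (c s) (c r₁) + riemannianEDist 𝓘(ℝ, E) (c s) (c r₂)))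
    (by simp [hr, e₁.ne_top, e₂.ne_top]) ?_
  refine (riemannianEDist_triangle (y := c r₁)).trans (add_le_add_right ?_ _)
  rw [riemannianEDist_comm (x := c s) (y := c r₁)]
  exact riemannianEDist_triangle

theorem toReal_riemannianEDist_sub_le {x y z : M} (hy : riemannianEDist 𝓘(ℝ, E) x y ≠ ⊤)
    {K : ℝ} (hK : 0 ≤ K) (hyz : riemannianEDist 𝓘(ℝ, E) y z ≤ ENNReal.ofReal K) :
    (riemannianEDist 𝓘(ℝ, E) x z).toReal ≤ (riemannianEDist 𝓘(ℝ, E) x y).toReal + K := by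
  refine ENNReal.toReal_le_of_le_ofReal (by positivity) ?_
  rw [ENNReal.ofReal_add ENNReal.toReal_nonneg hK, ENNReal.ofReal_toReal hy]
  exact riemannianEDist_triangle.trans (add_le_add_right hyz _)

theorem continuousOn_toReal_riemannianEDist (hc : ContinuousOn c (Icc 0 1)) :
    ContinuousOn (fun r ↦ (riemannianEDist 𝓘(ℝ, E) (c 0) (c r)).toReal) (Icc 0 1) := by
  intro s hs
  refine Metric.tendsto_nhds.2 fun ε hε ↦ ?_
  filter_upwards [(hc s hs).eventually (eventually_riemannianEDist_lt 𝓘(ℝ, E) (c s)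
    (ENNReal.ofReal_pos.2 (half_pos hε))), self_mem_nhdsWithin] with r hr hr1
  have h₁ := toReal_riemannianEDist_sub_le (riemannianEDist_ne_top_of_continuousOn hc s hs)
    (half_pos hε).le hr.le
  have h₂ := toReal_riemannianEDist_sub_le (riemannianEDist_ne_top_of_continuousOn hc r hr1)
    (half_pos hε).le (riemannianEDist_comm.trans_le hr.le)
  rw [Real.dist_eq, abs_lt]
  constructor <;> linarith

/-- A curve of speed at most `v`, in the metric sense, has length at most `∫ v`. -/
theorem riemannianEDist_le_ofReal_integral (hc : ContinuousOn c (Icc 0 1)) {v : ℝ → ℝ}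
    (hv : ContinuousOn v (Icc 0 1)) (hv0 : ∀ s ∈ Icc (0 : ℝ) 1, 0 ≤ v s)
    (hcv : ∀ s ∈ Ico (0 : ℝ) 1, ∀ K, v s < K → ∀ᶠ r in 𝓝[>] s,
      riemannianEDist 𝓘(ℝ, E) (c s) (c r) ≤ ENNReal.ofReal (K * (r - s))) :
    riemannianEDist 𝓘(ℝ, E) (c 0) (c 1) ≤ ENNReal.ofReal (∫ r in (0 : ℝ)..1, v r) := by
  set w : ℝ → ℝ := IccExtend zero_le_one ((Icc 0 1).domRestrict v) with hw
  have hwc : Continuous w := hv.domRestrict.Icc_extend'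
  have hwv : ∀ s ∈ Icc (0 : ℝ) 1, w s = v s := fun s hs ↦ by
    rw [hw, IccExtend_of_mem _ _ hs]; rfl
  have key := image_le_of_liminf_slope_right_le_deriv_boundary
    (continuousOn_toReal_riemannianEDist (E := E) hc)
    (B := fun r ↦ ∫ r in (0 : ℝ)..r, w r) (B' := w) (by simp [riemannianEDist_self])
    (fun r _ ↦ (hwc.integral_hasStrictDerivAt 0 r).hasDerivAt.continuousAt.continuousWithinAt)
    (fun r _ ↦ (hwc.integral_hasStrictDerivAt 0 r).hasDerivAt.hasDerivWithinAt)
    (fun s hs K hK ↦ by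
      have hs1 := Ico_subset_Icc_self hs
      rw [hwv s hs1] at hK
      obtain ⟨K₁, hK₁, hK₁K⟩ := exists_between hK
      refine Filter.Eventually.frequently ?_
      filter_upwards [hcv s hs K₁ hK₁, self_mem_nhdsWithin] with r hr hrs
      have hrs' : 0 < r - s := sub_pos.2 hrs
      have := toReal_riemannianEDist_sub_le (riemannianEDist_ne_top_of_continuousOn hc s hs1)
        (mul_nonneg ((hv0 s hs1).trans hK₁.le) hrs'.le) hr
      rw [slope_def_field, div_lt_iff₀ hrs']
      nlinarith) (right_mem_Icc.2 zero_le_one)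
  rw [← ENNReal.ofReal_toReal (riemannianEDist_ne_top_of_continuousOn (E := E) hc 1 (by simp))]
  refine ENNReal.ofReal_le_ofReal (key.trans_eq (intervalIntegral.integral_congr fun r hr ↦ ?_))
  rw [uIcc_of_le zero_le_one] at hr
  exact hwv r hr

theorem continuousOn_norm_velocity
    (hγ : ∀ t ∈ Icc (0 : ℝ) 1, ContMDiffAt 𝓘(ℝ, ℝ) 𝓘(ℝ, E) ∞ γ t) :
    ContinuousOn (fun r ↦ ‖mfderiv 𝓘(ℝ, ℝ) 𝓘(ℝ, E) γ r (1 : ℝ)‖) (Icc 0 1) :=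
  fun t ht ↦ (continuousAt_norm_mfderiv (hγ t ht)).continuousWithinAt

/-- The length of a smooth curve is the integral of its speed. -/
theorem pathELength_eq_ofReal_integral
    (hγ : ∀ t ∈ Icc (0 : ℝ) 1, ContMDiffAt 𝓘(ℝ, ℝ) 𝓘(ℝ, E) ∞ γ t) :
    pathELength 𝓘(ℝ, E) γ 0 1
      = ENNReal.ofReal (∫ r in (0 : ℝ)..1, ‖mfderiv 𝓘(ℝ, ℝ) 𝓘(ℝ, E) γ r (1 : ℝ)‖) := by
  rw [pathELength_eq_lintegral_mfderiv_Icc, intervalIntegral.integral_of_le zero_le_one,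
    ← MeasureTheory.integral_Icc_eq_integral_Ioc, MeasureTheory.ofReal_integral_eq_lintegral_ofReal]
  · simp only [ofReal_norm]
    rfl
  · exact (continuousOn_norm_velocity hγ).integrableOn_Icc
  · exact Filter.Eventually.of_forall fun r ↦ norm_nonneg _

theorem bddAbove_covDiffNorms
    (hX : ContMDiff 𝓘(ℝ, E) (𝓘(ℝ, E)).tangent ∞
      (fun x : M ↦ (⟨x, X x⟩ : TangentBundle 𝓘(ℝ, E) M))) {A : Set M} (hA : IsCompact A) :
    BddAbove (covDiffNorms 𝓘(ℝ, E) X A) := by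
  refine hA.induction_on (p := fun A ↦ BddAbove (covDiffNorms 𝓘(ℝ, E) X A)) ?_ ?_ ?_ ?_
  · simp [covDiffNorms]
  · exact fun s t hst ht ↦ ht.mono (image_mono hst)
  · intro s t hs ht
    rw [covDiffNorms, image_union]
    exact hs.union ht
  · intro x _
    obtain ⟨K, hK⟩ := exists_eventually_norm_leviCivita_le hX x
    exact ⟨_, mem_nhdsWithin_of_mem_nhds hK, K, by rintro _ ⟨y, hy, rfl⟩; exact hy⟩

variable [T2Space M]

/-- Under a bound on `‖∇X‖`, the flow of `X` expands the length of a curve at most at an exponential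
rate. -/
theorem riemannianEDist_flow_le
    (hX : ContMDiff 𝓘(ℝ, E) (𝓘(ℝ, E)).tangent ∞
      (fun x : M ↦ (⟨x, X x⟩ : TangentBundle 𝓘(ℝ, E) M)))
    (hγ : ∀ t ∈ Icc (0 : ℝ) 1, ContMDiffAt 𝓘(ℝ, ℝ) 𝓘(ℝ, E) ∞ γ t)
    {T : ℝ} (hS : Icc 0 T ×ˢ (γ '' Icc 0 1) ⊆ flowDomain X)
    {C : ℝ} (hC : ∀ t ∈ Icc 0 T, ∀ r ∈ Icc (0 : ℝ) 1,
      ‖leviCivita 𝓘(ℝ, E) M X (flow X t (γ r))‖ ≤ C) {t : ℝ} (ht : t ∈ Icc 0 T) :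
    riemannianEDist 𝓘(ℝ, E) (flow X t (γ 0)) (flow X t (γ 1))
      ≤ pathELength 𝓘(ℝ, E) γ 0 1 * ENNReal.ofReal (Real.exp (C * t)) := by
  have hγc : ContinuousOn γ (Icc 0 1) := fun s hs ↦ (hγ s hs).continuousAt.continuousWithinAt
  have hc : ContinuousOn (fun r ↦ flow X t (γ r)) (Icc 0 1) :=
    (continuousOn_flow hX hS).comp (f := fun r : ℝ ↦ (t, γ r)) (continuousOn_const.prodMk hγc)
      fun r hr ↦ ⟨ht, mem_image_of_mem γ hr⟩
  have hv := continuousOn_norm_velocity hγ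
  set ℓ := ∫ r in (0 : ℝ)..1, ‖mfderiv 𝓘(ℝ, ℝ) 𝓘(ℝ, E) γ r (1 : ℝ)‖ with hℓ
  have hle (ε : ℝ) (hε : 0 < ε) : riemannianEDist 𝓘(ℝ, E) (flow X t (γ 0)) (flow X t (γ 1))
      ≤ ENNReal.ofReal (Real.exp ((C + ε) * t) * ℓ) := by
    rw [hℓ, ← intervalIntegral.integral_const_mul]
    refine riemannianEDist_le_ofReal_integral (c := fun r ↦ flow X t (γ r)) hc
      (continuousOn_const.mul hv)
      (fun s _ ↦ mul_nonneg (Real.exp_pos _).le (norm_nonneg _)) fun s hs K hK ↦ ?_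
    exact eventually_riemannianEDist_flow_le hX hγc hS hC hs
      ((hγ s (Ico_subset_Icc_self hs)).mdifferentiableAt (by simp)).hasMFDerivAt hε ht hK
  have hlim : Filter.Tendsto (fun ε : ℝ ↦ ENNReal.ofReal (Real.exp ((C + ε) * t) * ℓ)) (𝓝[>] 0)
      (𝓝 (ENNReal.ofReal (Real.exp ((C + 0) * t) * ℓ))) :=
    ((ENNReal.continuous_ofReal.comp (by fun_prop)).tendsto (0 : ℝ)).mono_left nhdsWithin_le_nhds
  rw [pathELength_eq_ofReal_integral hγ, mul_comm, ← ENNReal.ofReal_mul (Real.exp_pos _).le]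
  rw [add_zero] at hlim
  exact ge_of_tendsto hlim (Filter.eventually_of_mem self_mem_nhdsWithin hle)

/-- The flow expands the distance of the endpoints of a minimizing geodesic segment `S` at most at
the exponential rate `C`, the supremum of `‖∇X‖` over the orbit of `S`, which is finite. -/
theorem exists_isLUB_covDiffNorms_and_riemannianEDist_flow_le
    (hX : ContMDiff 𝓘(ℝ, E) (𝓘(ℝ, E)).tangent ∞
      (fun x : M ↦ (⟨x, X x⟩ : TangentBundle 𝓘(ℝ, E) M)))
    {p₀ q₀ : M} {S : Set M} (hS : IsMinimizingGeodesicSegment 𝓘(ℝ, E) S p₀ q₀)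
    {T : ℝ} (hT : 0 < T) (hST : Icc 0 T ×ˢ S ⊆ flowDomain X) :
    ∃ C : ℝ, IsLUB (covDiffNorms 𝓘(ℝ, E) X (Function.uncurry (flow X) '' (Icc 0 T ×ˢ S))) C ∧
      ∀ t ∈ Icc 0 T, riemannianEDist 𝓘(ℝ, E) (flow X t p₀) (flow X t q₀)
        ≤ riemannianEDist 𝓘(ℝ, E) p₀ q₀ * ENNReal.ofReal (Real.exp (C * t)) := by
  obtain ⟨γ, hgeo, rfl, rfl, hlen, rfl⟩ := hS
  have hγ : ∀ t ∈ Icc (0 : ℝ) 1, ContMDiffAt 𝓘(ℝ, ℝ) 𝓘(ℝ, E) ∞ γ t := fun t ht ↦ (hgeo t ht).1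
  have hγc : ContinuousOn γ (Icc 0 1) := fun s hs ↦ (hγ s hs).continuousAt.continuousWithinAt
  have hcpt : IsCompact (Function.uncurry (flow X) '' (Icc 0 T ×ˢ (γ '' Icc 0 1))) :=
    (isCompact_Icc.prod (isCompact_Icc.image_of_continuousOn hγc)).image_of_continuousOn
      (continuousOn_flow hX hST)
  have hlub := isLUB_csSup (s := covDiffNorms 𝓘(ℝ, E) X
    (Function.uncurry (flow X) '' (Icc 0 T ×ˢ (γ '' Icc 0 1))))
    ((((nonempty_Icc.2 hT.le).prod ((nonempty_Icc.2 zero_le_one).image γ)).image _).image _)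
    (bddAbove_covDiffNorms hX hcpt)
  refine ⟨_, hlub, fun t ht ↦ ?_⟩
  rw [← hlen]
  exact riemannianEDist_flow_le hX hγ hST (fun t ht r hr ↦ hlub.1 (mem_image_of_mem _
    ⟨(t, γ r), ⟨ht, mem_image_of_mem γ hr⟩, rfl⟩)) ht

end Length

end RiemannianGronwall

end

theorem corollary4
    {E : Type*} [NormedAddCommGroup E] [NormedSpace ℝ E] [FiniteDimensional ℝ E]
    {M : Type*} [TopologicalSpace M] [T2Space M] [ConnectedSpace M]
    [ChartedSpace E M] [IsManifold 𝓘(ℝ, E) ∞ M]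
    [RiemannianBundle (fun x : M ↦ TangentSpace 𝓘(ℝ, E) x)]
    [IsContMDiffRiemannianBundle 𝓘(ℝ, E) ∞ E (fun x : M ↦ TangentSpace 𝓘(ℝ, E) x)]
    (hM : RiemannianGronwall.GeodesicallyComplete 𝓘(ℝ, E) M)
    (X : Π x : M, TangentSpace 𝓘(ℝ, E) x)
    (hX : ContMDiff 𝓘(ℝ, E) (𝓘(ℝ, E)).tangent ∞
      (fun x : M ↦ (⟨x, X x⟩ : TangentBundle 𝓘(ℝ, E) M)))
    (p₀ q₀ : M) (S : Set M)
    (hS : RiemannianGronwall.IsMinimizingGeodesicSegment 𝓘(ℝ, E) S p₀ q₀) :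
    (∀ T : ℝ, 0 < T → Icc 0 T ×ˢ S ⊆ RiemannianGronwall.flowDomain X →
      ∃ C : ℝ,
        IsLUB (RiemannianGronwall.covDiffNorms 𝓘(ℝ, E) X
          (Function.uncurry (RiemannianGronwall.flow X) '' (Icc 0 T ×ˢ S))) C ∧
        ∀ t ∈ Icc 0 T,
          riemannianEDist 𝓘(ℝ, E) (RiemannianGronwall.flow X t p₀) (RiemannianGronwall.flow X t q₀)
            ≤ riemannianEDist 𝓘(ℝ, E) p₀ q₀ * ENNReal.ofReal (Real.exp (C * t))) ∧
    (RiemannianGronwall.IsCompleteVectorField X → ∀ T : ℝ, 0 < T →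
      ∃ C : ℝ,
        IsLUB (RiemannianGronwall.covDiffNorms 𝓘(ℝ, E) X
          (Function.uncurry (RiemannianGronwall.flow X) '' (Icc 0 T ×ˢ S))) C ∧
        ∀ t ∈ Icc 0 T,
          riemannianEDist 𝓘(ℝ, E) (RiemannianGronwall.flow X t p₀) (RiemannianGronwall.flow X t q₀)
            ≤ riemannianEDist 𝓘(ℝ, E) p₀ q₀ * ENNReal.ofReal (Real.exp (C * t))) :=
  ⟨fun _ hT hST ↦ RiemannianGronwall.exists_isLUB_covDiffNorms_and_riemannianEDist_flow_le hX hS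
      hT hST,
    fun hc _ hT ↦ RiemannianGronwall.exists_isLUB_covDiffNorms_and_riemannianEDist_flow_le hX hS
      hT (hc ▸ subset_univ _)⟩
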